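/- Let $q_0\ge 1$ be a fixed integer and let $q_j=[j^{1/2}]$ (integer part) for $j=1,2,\dots$. For integers $M\ge 1$ and $N\ge 0$ consider all ways of placing $N$ indistinguishable balls into boxes $U_0,U_1,U_2,\dots$, where $U_j$ is divided into $q_j$ compartments, subject to $\sum_{j\ge 0} jN_j\le M$, where $N_j$ is the number of balls in $U_j$ (so $\sum_{j\ge0} N_j=N$). All allocations of balls to compartments are taken to be equiprobable; that is, a sequence $(N_j)_{j\ge 0}$ of nonnegative integers with $\sum_j N_j=N$ and $\sum_j jN_j\le M$ has probability proportional to $\prod_{j\ge 0}\binom{q_j+N_j-1}{N_j}$. Let $\mathsf P=\mathsf P_{q_0,M,N}$ denote this probability. (1) For every integer $M\ge1$ the equation $$\sum_{j=1}^\infty \frac{j\,q_j}{e^{\beta j}-1}=M$$ has exactly one positive root $\beta=\beta(M)$, and for it the series $$N_{cr}=N_{cr}(M)=\sum_{j=1}^\infty\frac{q_j}{e^{\beta j}-1}$$ converges. (2) For $\varepsilon>0$ put $\Delta=\Delta(M)=N_{cr}^{2/3+\varepsilon}$. For every $q_0\ge1$, every $\varepsilon>0$ and every $m=1,2,\dots$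 there is a constant $C_m$, depending only on $q_0$, $\varepsilon$ and $m$, such that for all integers $M\ge1$ and all integers $N>N_{cr}(M)$ $$\mathsf P\bigl(|N_0-(N-N_{cr})|>\Delta\bigr)\le C_m\,N_{cr}^{-m}.$$ (3) Consequently the excess balls condense into $U_0$: for fixed $q_0\ge1$ and $\varepsilon>0$, $\mathsf P(|N_0-(N-N_{cr})|\le\Delta)\to1$ as $M\to\infty$, uniformly in the integers $N>N_{cr}(M)$. (4) As $M\to\infty$, $$N_{cr}(M)\sim \frac{M^{3/5}\,\Gamma(\tfrac32)\,\zeta(\tfrac32)}{\bigl(\Gamma(\tfrac52)\,\zeta(\tfrac52)\bigr)^{3/5}},$$ where $\zeta$ is the Riemann zeta function. -/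

import Mathlib

namespace BoxCondensation

/-- The integer part `[j^{1/2}]`. -/
noncomputable def q (j : ℕ) : ℕ := ⌊Real.sqrt (j : ℝ)⌋₊

/-- The multiplicities (numbers of compartments): `q_0 = q0` and `q_j = [j^{1/2}]` for `j ≥ 1`. -/
noncomputable def mult (q0 j : ℕ) : ℕ := if j = 0 then q0 else q j

/-- The sequences `(N_0, N_1, N_2, …)` of nonnegative integers with `∑ N_j = N` and
`∑ j N_j ≤ M`. (Such sequences have finite support, because `∑ N_j = N`.) -/
def configs (M N : ℕ) : Set (ℕ →₀ ℕ) :=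
  {n | (n.sum fun _ k => k) = N ∧ (n.sum fun j k => j * k) ≤ M}

theorem configs_finite (M N : ℕ) : (configs M N).Finite := by
  refine (Finset.finite_toSet
    ((Finset.range (M + 1)).finsupp fun _ => Finset.range (N + 1))).subset ?_
  rintro n ⟨h1, h2⟩
  rw [Finset.mem_coe, Finset.mem_finsupp_iff]
  have key : ∀ j ∈ n.support, j < M + 1 ∧ n j < N + 1 := by
    intro j hj
    have a : n j ≤ N := by
      rw [← h1]
      exact Finset.single_le_sum (f := fun i => n i) (fun _ _ => Nat.zero_le _) hj
    have b : j * n j ≤ M :=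
      (Finset.single_le_sum (f := fun i => i * n i) (fun _ _ => Nat.zero_le _) hj).trans h2
    have c : 1 ≤ n j := Nat.one_le_iff_ne_zero.mpr (Finsupp.mem_support_iff.mp hj)
    exact ⟨Nat.lt_succ_of_le ((Nat.le_mul_of_pos_right j c).trans b), Nat.lt_succ_of_le a⟩
  refine ⟨fun j hj => Finset.mem_range.mpr (key j hj).1, fun j _ => ?_⟩
  rw [Finset.mem_range]
  by_cases h : j ∈ n.support
  · exact (key j h).2
  · rw [Finsupp.notMem_support_iff.mp h]
    exact Nat.succ_pos N

/-- The number of allocations of indistinguishable balls to compartments that realize the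
sequence `n`: the product over the boxes of `binom (q_j + N_j - 1) N_j`. The boxes outside the
support contribute the factor `1`. -/
noncomputable def weight (q0 : ℕ) (n : ℕ →₀ ℕ) : ℕ :=
  n.prod fun j k => (mult q0 j + k - 1).choose k

open Classical in
/-- The probability of an event `A` when all allocations of `N` indistinguishable balls to
compartments with `∑ j N_j ≤ M` are equiprobable. -/
noncomputable def prob (q0 M N : ℕ) (A : Set (ℕ →₀ ℕ)) : ℝ :=
  (∑ n ∈ (configs_finite M N).toFinset with n ∈ A, (weight q0 n : ℝ)) /
    ∑ n ∈ (configs_finite M N).toFinset, (weight q0 n : ℝ)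

/-- `β` is a positive root of `∑_{j ≥ 1} j q_j / (e^{β j} - 1) = M`, the series being convergent.
The terms are indexed by `j = i + 1`; the value of `q_0` plays no role. -/
def IsRoot (M : ℕ) (β : ℝ) : Prop :=
  0 < β ∧ HasSum
    (fun i : ℕ => ((i + 1 : ℕ) : ℝ) * (q (i + 1) : ℝ) /
      (Real.exp (β * ((i + 1 : ℕ) : ℝ)) - 1)) (M : ℝ)

/-- The positive root `β = β(M)`. -/
noncomputable def root (M : ℕ) : ℝ := Classical.epsilon (IsRoot M)

/-- The terms `q_j / (e^{β j} - 1)`, `j = i + 1 ≥ 1`, of the series for `N_cr`. -/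
noncomputable def critTerm (M i : ℕ) : ℝ :=
  (q (i + 1) : ℝ) / (Real.exp (root M * ((i + 1 : ℕ) : ℝ)) - 1)

/-- `N_cr(M) = ∑_{j ≥ 1} q_j / (e^{β j} - 1)` with `β = β(M)`. -/
noncomputable def Ncr (M : ℕ) : ℝ := ∑' i : ℕ, critTerm M i

/-- `Δ = N_cr^{2/3 + ε}`. -/
noncomputable def width (ε : ℝ) (M : ℕ) : ℝ := Ncr M ^ (2 / 3 + ε)

end BoxCondensation

/-!
Write `S` and `E` for the number of balls and the energy in the boxes `U_j`, `j ≥ 1`, and let `Z`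
be the product of `(1 - e^{-βj})^{-q_j}` over `1 ≤ j ≤ M`. Under the Boltzmann weights `e^{-βE} / Z` the
balls in distinct compartments are independent geometric variables, and `β` is chosen so that `E`
has mean `M` and `S` has mean `N_cr` (up to the negligible boxes `j > M`). As `N_0 = N - S`, the
claim is a concentration statement for `S` under the constraint `E ≤ M`. The box `U_0` contributes a
factor that varies only polynomially in `M` (`prob_le`), and the asymptotics of all quantities come
from `tendsto_mom`: the moments `∑ j^p q_j / (e^{βj} - 1)` are Riemann sums with mesh `β` of the
integrals `Γ(p + 3/2) ζ(p + 3/2)`. In particular `β` is of order `N_cr^{-2/3}`.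

*Upper bound* (`sum_deviating_le`). The variance of `S` is of order `β⁻²`, and a Chernoff bound with
exponent `± β / 4` shows that the allocations with `|S - N_cr| > D` and `E ≤ M` number at most
`O(e^{βM} Z e^{-βD/4})`. For `D = N_cr^{2/3+ε}` the last factor is `exp (-c N_cr^ε)`.

*Lower bound* (`le_sum_excitedWeight`). It remains to see that the number of all allocations is at
least `e^{βM} Z` up to a factor `exp (-K (log M)^5)`. For this `E` has to lie within
`O(polylog / β)` below `M`, a window much narrower than the standard deviation of `E`, while
`S ≤ N_cr`. The second condition is forced by leaving the boxes `U_1, …, U_J` empty with `J` of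
order `(log M)²`: this lowers the mean of `S` by about `√J / β`, many standard deviations, and the
mean of `E` by at most `J² / β`. For the first one the compartments are truncated so that each carries energy
at most `b = 8 log M / β`. Then `anticoncentration` applies: a sum of `T` independent variables
with values in `[0, b]` is within `b` of its mean with probability at least `1 / (16 (T + 1)³)`.
Its proof replaces a local limit theorem by a discrete intermediate value argument: resample the
variables one at a time, from an outcome below the mean to one above it. Every intermediate outcome
has the same law, and one of them lies in the window.
-/

open Filter Topology

namespace BoxCondensation

/-! ### The moments of the Bose distribution and the root `β` -/

/-- The mean occupation number `1 / (e^x - 1)` of a state of reduced energy `x`. -/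
noncomputable def bose (x : ℝ) : ℝ := (Real.exp x - 1)⁻¹

/-- The term `j ^ p * q_j / (e^{β j} - 1)` with `j = i + 1`. -/
noncomputable def momTerm (p : ℕ) (β : ℝ) (i : ℕ) : ℝ :=
  ((i + 1 : ℕ) : ℝ) ^ p * (q (i + 1) : ℝ) * bose (β * ((i + 1 : ℕ) : ℝ))

/-- The moment `∑_{j ≥ 1} j ^ p q_j / (e^{β j} - 1)`. -/
noncomputable def mom (p : ℕ) (β : ℝ) : ℝ := ∑' i, momTerm p β i

theorem q_le_sqrt (j : ℕ) : (q j : ℝ) ≤ Real.sqrt j := Nat.floor_le (Real.sqrt_nonneg _)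

theorem one_le_q {j : ℕ} (hj : 1 ≤ j) : 1 ≤ q j := by
  refine Nat.le_floor ?_
  rw [Nat.cast_one, Real.one_le_sqrt]
  exact_mod_cast hj

theorem sqrt_div_two_le_q {j : ℕ} (hj : 1 ≤ j) : Real.sqrt j / 2 ≤ (q j : ℝ) := by
  have h1 : Real.sqrt j < q j + 1 := Nat.lt_floor_add_one _
  have h2 : (1 : ℝ) ≤ q j := by exact_mod_cast one_le_q hj
  linarith

theorem q_le_self (j : ℕ) : q j ≤ j := by
  refine (Nat.floor_le_floor ?_).trans (Nat.floor_natCast (R := ℝ) j).le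
  rw [Real.sqrt_le_left (Nat.cast_nonneg _)]
  rcases Nat.eq_zero_or_pos j with rfl | h
  · simp
  · exact le_self_pow₀ (by exact_mod_cast h) two_ne_zero

theorem bose_pos {x : ℝ} (hx : 0 < x) : 0 < bose x :=
  inv_pos.mpr (sub_pos.mpr (Real.one_lt_exp_iff.mpr hx))

theorem bose_anti {x y : ℝ} (hx : 0 < x) (hxy : x ≤ y) : bose y ≤ bose x :=
  inv_anti₀ (sub_pos.mpr (Real.one_lt_exp_iff.mpr hx))
    (sub_le_sub_right (Real.exp_le_exp.mpr hxy) 1)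

theorem bose_strictAnti {x y : ℝ} (hx : 0 < x) (hxy : x < y) : bose y < bose x :=
  inv_strictAnti₀ (sub_pos.mpr (Real.one_lt_exp_iff.mpr hx))
    (sub_lt_sub_right (Real.exp_lt_exp.mpr hxy) 1)

/-- This is `2 sinh (x / 2) ≥ x`. -/
theorem mul_bose_le {x : ℝ} (hx : 0 < x) : x * bose x ≤ Real.exp (-(x / 2)) := by
  have h := Real.self_le_sinh_iff.mpr (half_pos hx).le
  rw [Real.sinh_eq] at h
  have e1 : Real.exp x = Real.exp (x / 2) * Real.exp (x / 2) := by
    rw [← Real.exp_add, add_halves]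
  have e2 : Real.exp (x / 2) * Real.exp (-(x / 2)) = 1 := by rw [← Real.exp_add]; simp
  have h0 : 0 < Real.exp x - 1 := sub_pos.mpr (Real.one_lt_exp_iff.mpr hx)
  rw [bose, ← div_eq_mul_inv, div_le_iff₀ h0, e1]
  have := Real.exp_pos (-(x / 2))
  have : Real.exp (-(x / 2)) * (Real.exp (x / 2) * Real.exp (x / 2) - 1) =
    Real.exp (x / 2) - Real.exp (-(x / 2)) := by linear_combination Real.exp (x / 2) * e2
  linarith

theorem mul_bose_le_one {x : ℝ} (hx : 0 < x) : x * bose x ≤ 1 :=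
  (mul_bose_le hx).trans (Real.exp_le_one_iff.mpr (by linarith))

theorem half_le_mul_bose {x : ℝ} (hx : 0 < x) (hx1 : x ≤ 1) : 1 / 2 ≤ x * bose x := by
  have h0 : 0 < Real.exp x - 1 := sub_pos.mpr (Real.one_lt_exp_iff.mpr hx)
  have h := Real.abs_exp_sub_one_le (x := x) (by rwa [abs_of_pos hx])
  rw [abs_of_pos h0, abs_of_pos hx] at h
  rw [bose, ← div_eq_mul_inv, le_div_iff₀ h0]
  linarith

theorem momTerm_pos (p : ℕ) {β : ℝ} (hβ : 0 < β) (i : ℕ) : 0 < momTerm p β i := by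
  have : 0 < q (i + 1) := one_le_q (Nat.le_add_left 1 i)
  have := bose_pos (x := β * ((i + 1 : ℕ) : ℝ)) (by positivity)
  unfold momTerm
  positivity

theorem momTerm_anti (p : ℕ) {a β : ℝ} (ha : 0 < a) (h : a ≤ β) (i : ℕ) :
    momTerm p β i ≤ momTerm p a i := by
  unfold momTerm
  refine mul_le_mul_of_nonneg_left (bose_anti (by positivity) ?_) (by positivity)
  gcongr

theorem summable_momTerm (p : ℕ) {β : ℝ} (hβ : 0 < β) : Summable (momTerm p β) := by
  have hs : Summable fun i : ℕ =>
      β⁻¹ * (((i + 1 : ℕ) : ℝ) ^ p * Real.exp (-(β / 2) * ((i + 1 : ℕ) : ℝ))) := by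
    refine Summable.mul_left _ ?_
    exact (summable_nat_add_iff (f := fun i : ℕ => (i : ℝ) ^ p * Real.exp (-(β / 2) * i)) 1).mpr
      (Real.summable_pow_mul_exp_neg_nat_mul p (half_pos hβ))
  refine Summable.of_nonneg_of_le (fun i => (momTerm_pos p hβ i).le) (fun i => ?_) hs
  set j : ℕ := i + 1 with hj
  have hj0 : (0 : ℝ) < j := by positivity
  have h1 := mul_bose_le (x := β * j) (by positivity)
  have h2 : (q j : ℝ) ≤ j := by exact_mod_cast q_le_self j
  have h3 := (bose_pos (x := β * j) (by positivity)).le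
  have h4 : (j : ℝ) * bose (β * j) ≤ β⁻¹ * Real.exp (-(β / 2) * j) := by
    rw [le_inv_mul_iff₀ hβ]
    refine le_trans (le_of_eq (by ring)) (h1.trans (le_of_eq ?_))
    congr 1; ring
  calc momTerm p β i = (j : ℝ) ^ p * ((q j : ℝ) * bose (β * j)) := by
        simp only [momTerm, ← hj]; ring
    _ ≤ (j : ℝ) ^ p * (j * bose (β * j)) := by gcongr
    _ ≤ (j : ℝ) ^ p * (β⁻¹ * Real.exp (-(β / 2) * j)) := by gcongr
    _ = _ := by ring

theorem isRoot_iff {M : ℕ} {β : ℝ} : IsRoot M β ↔ 0 < β ∧ mom 1 β = M := by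
  have e : (fun i : ℕ => ((i + 1 : ℕ) : ℝ) * (q (i + 1) : ℝ) /
      (Real.exp (β * ((i + 1 : ℕ) : ℝ)) - 1)) = momTerm 1 β := by
    funext i; simp only [momTerm, bose, pow_one]; rfl
  unfold IsRoot
  rw [e]
  refine and_congr_right fun hβ => ?_
  exact (summable_momTerm 1 hβ).hasSum_iff

theorem continuousOn_mom (p : ℕ) : ContinuousOn (mom p) (Set.Ioi 0) := by
  intro β hβ
  have ha : 0 < β / 2 := half_pos hβ
  have hc : ContinuousOn (mom p) (Set.Ici (β / 2)) := by
    refine continuousOn_tsum (u := momTerm p (β / 2)) (fun i => ?_) (summable_momTerm p ha) ?_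
    · refine ContinuousOn.mul continuousOn_const (ContinuousOn.inv₀ (by fun_prop) fun x hx => ?_)
      exact (sub_pos.mpr (Real.one_lt_exp_iff.mpr
        (mul_pos (ha.trans_le hx) (by positivity)))).ne'
    · intro i x hx
      rw [Real.norm_of_nonneg (momTerm_pos p (ha.trans_le hx) i).le]
      exact momTerm_anti p ha hx i
  exact (hc.continuousAt (Ici_mem_nhds (half_lt_self hβ))).continuousWithinAt

theorem mom_strictAnti (p : ℕ) {a b : ℝ} (ha : 0 < a) (hab : a < b) : mom p b < mom p a := by
  refine Summable.tsum_lt_tsum (i := 0) (fun i => momTerm_anti p ha hab.le i) ?_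
    (summable_momTerm p (ha.trans hab)) (summable_momTerm p ha)
  have : (0 : ℝ) < q (0 + 1) := by exact_mod_cast one_le_q (j := 0 + 1) le_rfl
  unfold momTerm
  exact mul_lt_mul_of_pos_left (bose_strictAnti (by simpa using ha) (by simpa using hab))
    (by positivity)

/-- For `β ≥ 1` the moments decay exponentially, since `e^{β j} - 1 ≥ e^{β - 1} (e^j - 1)`. -/
theorem mom_le_exp_mul (p : ℕ) {β : ℝ} (hβ : 1 ≤ β) :
    mom p β ≤ Real.exp (-(β - 1)) * mom p 1 := by
  unfold mom
  rw [← tsum_mul_left]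
  refine Summable.tsum_le_tsum (fun i => ?_) (summable_momTerm p (by linarith))
    ((summable_momTerm p one_pos).mul_left _)
  have hj : (1 : ℝ) ≤ ((i + 1 : ℕ) : ℝ) := by exact_mod_cast Nat.le_add_left 1 i
  unfold momTerm
  set j : ℝ := ((i + 1 : ℕ) : ℝ)
  have h : bose (β * j) ≤ Real.exp (-(β - 1)) * bose (1 * j) := by
    unfold bose
    rw [Real.exp_neg, ← mul_inv]
    have h0 : 0 < Real.exp (1 * j) - 1 := sub_pos.mpr (Real.one_lt_exp_iff.mpr (by linarith))
    refine inv_anti₀ (mul_pos (Real.exp_pos _) h0) ?_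
    rw [mul_sub, ← Real.exp_add, mul_one]
    have h1 : Real.exp (β - 1 + 1 * j) ≤ Real.exp (β * j) :=
      Real.exp_le_exp.mpr (by nlinarith)
    have h2 : 1 ≤ Real.exp (β - 1) := Real.one_le_exp (by linarith)
    linarith
  calc _ ≤ j ^ p * (q (i + 1) : ℝ) * (Real.exp (-(β - 1)) * bose (1 * j)) := by gcongr
    _ = _ := by ring

theorem exists_mom_one_eq {M : ℕ} (hM : 1 ≤ M) : ∃ β : ℝ, 0 < β ∧ mom 1 β = M := by
  have hM0 : (0 : ℝ) < M := by exact_mod_cast hM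
  -- at `a = log (1 + 1 / M)` the first term alone equals `M`
  set a := Real.log (1 + (M : ℝ)⁻¹) with ha
  have ha0 : 0 < a := Real.log_pos (by have := inv_pos.mpr hM0; linarith)
  have h1 : (M : ℝ) ≤ mom 1 a := by
    refine le_trans (le_of_eq ?_) ((summable_momTerm 1 ha0).le_tsum 0
      fun i _ => (momTerm_pos 1 ha0 i).le)
    have hq : q 1 = 1 := le_antisymm (q_le_self 1) (one_le_q le_rfl)
    simp only [momTerm, bose, zero_add, hq, Nat.cast_one, mul_one, one_pow, one_mul]
    rw [ha, Real.exp_log (by positivity), add_sub_cancel_left, inv_inv]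
  have h2 : ∃ b, a ≤ b ∧ mom 1 b ≤ M := by
    have ht : Tendsto (fun β : ℝ => Real.exp (-(β - 1)) * mom 1 1) atTop (𝓝 (0 * mom 1 1)) :=
      (Real.tendsto_exp_neg_atTop_nhds_zero.comp
        (tendsto_atTop_add_const_right atTop (-1 : ℝ) tendsto_id)).mul_const _
    rw [zero_mul] at ht
    obtain ⟨b, hb1, hb2, hb3⟩ := ((ht.eventually_le_const hM0).and
      ((eventually_ge_atTop a).and (eventually_ge_atTop 1))).exists
    exact ⟨b, hb2, (mom_le_exp_mul 1 hb3).trans hb1⟩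
  obtain ⟨b, hab, hb⟩ := h2
  have hc : ContinuousOn (mom 1) (Set.Icc a b) :=
    (continuousOn_mom 1).mono fun x hx => ha0.trans_le hx.1
  obtain ⟨β, hβ, e⟩ := intermediate_value_Icc' hab hc ⟨hb, h1⟩
  exact ⟨β, ha0.trans_le hβ.1, e⟩

theorem existsUnique_isRoot {M : ℕ} (hM : 1 ≤ M) : ∃! β : ℝ, IsRoot M β := by
  obtain ⟨β, hβ, e⟩ := exists_mom_one_eq hM
  refine ⟨β, isRoot_iff.mpr ⟨hβ, e⟩, fun γ hγ => ?_⟩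
  obtain ⟨hγ0, eγ⟩ := isRoot_iff.mp hγ
  rcases lt_trichotomy γ β with h | h | h
  · have := mom_strictAnti 1 hγ0 h; linarith
  · exact h
  · have := mom_strictAnti 1 hβ h; linarith

theorem isRoot_root {M : ℕ} (hM : 1 ≤ M) : IsRoot M (root M) :=
  Classical.epsilon_spec (existsUnique_isRoot hM).exists

theorem root_pos {M : ℕ} (hM : 1 ≤ M) : 0 < root M := (isRoot_root hM).1

theorem mom_one_root {M : ℕ} (hM : 1 ≤ M) : mom 1 (root M) = M :=
  (isRoot_iff.mp (isRoot_root hM)).2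

theorem critTerm_eq (M : ℕ) : critTerm M = momTerm 0 (root M) := by
  funext i; simp only [critTerm, momTerm, bose, pow_zero, one_mul]; rfl

theorem Ncr_eq (M : ℕ) : Ncr M = mom 0 (root M) := by
  simp only [Ncr, mom, critTerm_eq]

theorem summable_critTerm {M : ℕ} (hM : 1 ≤ M) : Summable (critTerm M) := by
  rw [critTerm_eq]; exact summable_momTerm 0 (root_pos hM)

theorem Ncr_pos {M : ℕ} (hM : 1 ≤ M) : 0 < Ncr M := by
  rw [Ncr_eq]
  exact (summable_momTerm 0 (root_pos hM)).tsum_pos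
    (fun i => (momTerm_pos 0 (root_pos hM) i).le) 0 (momTerm_pos 0 (root_pos hM) 0)

/-! ### Asymptotics of the moments -/

section RiemannSums

open MeasureTheory Set

/-- The Bose integral `∫_0^∞ x^{p + 1/2} / (e^x - 1) dx = Γ(p + 3/2) ζ(p + 3/2)`. -/
noncomputable def boseConst (p : ℕ) : ℝ :=
  Real.Gamma (p + 3 / 2) * (riemannZeta ((p : ℂ) + 3 / 2)).re

theorem hasSum_exp_neg_bose {t : ℝ} (ht : 0 < t) :
    HasSum (fun i : ℕ => Real.exp (-((i : ℝ) + 1) * t)) (bose t) := by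
  have h1 : Real.exp (-t) < 1 := Real.exp_zero ▸ Real.exp_lt_exp.mpr (by linarith)
  have h := (hasSum_geometric_of_lt_one (Real.exp_pos _).le h1).mul_left (Real.exp (-t))
  have e1 : (fun i : ℕ => Real.exp (-((i : ℝ) + 1) * t)) =
      fun i : ℕ => Real.exp (-t) * Real.exp (-t) ^ i := by
    funext i
    rw [← Real.exp_nat_mul, ← Real.exp_add]
    congr 1; ring
  have e2 : bose t = Real.exp (-t) * (1 - Real.exp (-t))⁻¹ := by
    simp only [bose, Real.exp_neg]
    have := Real.exp_pos t
    have h2 : Real.exp t - 1 ≠ 0 := (sub_pos.mpr (Real.one_lt_exp_iff.mpr ht)).ne'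
    have h3 : 1 - (Real.exp t)⁻¹ ≠ 0 := by
      rw [← Real.exp_neg]; linarith
    field_simp
  rw [e1, e2]
  exact h

/-- The Mellin transform of `1 / (e^x - 1) = ∑ e^{-kx}` is a Dirichlet series. -/
theorem integral_bose (p : ℕ) :
    ∫ x in Ioi (0 : ℝ), x ^ p * Real.sqrt x * bose x = boseConst p := by
  have hs : (1 : ℝ) < (p : ℝ) + 3 / 2 := by
    have : (0 : ℝ) ≤ p := Nat.cast_nonneg p
    linarith
  set s : ℂ := (((p : ℝ) + 3 / 2 : ℝ) : ℂ) with hsdef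
  have hre : s.re = (p : ℝ) + 3 / 2 := Complex.ofReal_re _
  have h1 : HasSum (fun i : ℕ => Complex.Gamma s * (1 : ℂ) / (((i : ℝ) + 1 : ℝ) : ℂ) ^ s)
      (mellin (fun t => (bose t : ℂ)) s) := by
    refine hasSum_mellin (fun i => Or.inr (by positivity)) (by rw [hre]; linarith) ?_ ?_
    · intro t ht
      simpa using Complex.hasSum_ofReal.mpr (hasSum_exp_neg_bose ht)
    · rw [hre]
      simpa using (summable_nat_add_iff 1).mpr (Real.summable_one_div_nat_rpow.mpr hs)
  have h2 : mellin (fun t => (bose t : ℂ)) s =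
      ((∫ x in Ioi (0 : ℝ), x ^ p * Real.sqrt x * bose x : ℝ) : ℂ) := by
    rw [mellin, ← integral_complex_ofReal]
    refine setIntegral_congr_fun measurableSet_Ioi fun t ht => ?_
    have ht' : (0 : ℝ) < t := ht
    have e : s - 1 = (((p : ℝ) + 1 / 2 : ℝ) : ℂ) := by rw [hsdef]; push_cast; ring
    simp only [smul_eq_mul]
    rw [e, ← Complex.ofReal_cpow ht'.le, Real.rpow_add ht', Real.rpow_natCast,
      ← Real.sqrt_eq_rpow]
    push_cast; ring
  have h3 := h1.tsum_eq
  rw [h2] at h3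
  have h4 : ∑' i : ℕ, Complex.Gamma s * (1 : ℂ) / (((i : ℝ) + 1 : ℝ) : ℂ) ^ s =
      Complex.Gamma s * riemannZeta s := by
    rw [zeta_eq_tsum_one_div_nat_add_one_cpow (by rw [hre]; exact hs), ← tsum_mul_left]
    refine tsum_congr fun i => ?_
    push_cast; ring
  rw [h4, hsdef, Complex.Gamma_ofReal] at h3
  have h5 := congrArg Complex.re h3
  rw [Complex.re_ofReal_mul, Complex.ofReal_re] at h5
  rw [← h5, boseConst]
  push_cast; rfl

/-- The Riemann-sum step function: on `(β (j - 1), β j]` it equals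
`β^{p + 1/2} j^p q_j / (e^{β j} - 1)`. -/
noncomputable def stepFun (p : ℕ) (β x : ℝ) : ℝ :=
  (β * (⌈x / β⌉₊ : ℝ)) ^ p * (Real.sqrt β * q ⌈x / β⌉₊) * bose (β * ⌈x / β⌉₊)

theorem measurable_stepFun (p : ℕ) (β : ℝ) : Measurable (stepFun p β) := by
  have h : Measurable fun n : ℕ => (β * (n : ℝ)) ^ p * (Real.sqrt β * q n) * bose (β * n) :=
    measurable_from_nat
  exact h.comp (Nat.measurable_ceil.comp (measurable_id.div_const β))

theorem le_mul_ceil {β x : ℝ} (hβ : 0 < β) : x ≤ β * ⌈x / β⌉₊ := by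
  rw [← div_le_iff₀' hβ]; exact Nat.le_ceil _

theorem mul_ceil_lt {β x : ℝ} (hβ : 0 < β) (hx : 0 < x) : β * ⌈x / β⌉₊ < x + β := by
  have := Nat.ceil_lt_add_one (div_pos hx hβ).le
  calc β * ⌈x / β⌉₊ < β * (x / β + 1) := by gcongr
    _ = x + β := by field_simp

theorem pow_mul_exp_neg_le (p : ℕ) {y : ℝ} (hy : 0 ≤ y) :
    y ^ p * Real.exp (-(y / 4)) ≤ 4 ^ p * p.factorial := by
  have h := Real.pow_div_factorial_le_exp (y / 4) (by positivity) p
  have hp : (0 : ℝ) < p.factorial := by exact_mod_cast p.factorial_pos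
  rw [div_le_iff₀ hp, div_pow, div_le_iff₀ (by positivity)] at h
  rw [Real.exp_neg, ← div_eq_mul_inv, div_le_iff₀ (Real.exp_pos _)]
  linarith

/-- A bound uniform in `β`: with `y = β ⌈x / β⌉ ≥ x` the step function is at most
`y ^ p * √y / (e ^ y - 1) ≤ y ^ (p - 1 / 2) * e ^ (-y / 2)`. -/
theorem norm_stepFun_le (p : ℕ) {β x : ℝ} (hβ : 0 < β) (hx : 0 < x) :
    ‖stepFun p β x‖ ≤ (4 ^ p * p.factorial) * (x ^ (-(1 / 2) : ℝ) * Real.exp (-(1 / 4) * x)) := by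
  have hy0 : x ≤ β * (⌈x / β⌉₊ : ℝ) := le_mul_ceil hβ
  have hjpos : (0 : ℝ) ≤ (⌈x / β⌉₊ : ℝ) := Nat.cast_nonneg _
  have hb : Real.sqrt β * q ⌈x / β⌉₊ ≤ Real.sqrt (β * (⌈x / β⌉₊ : ℝ)) := by
    rw [Real.sqrt_mul hβ.le]
    exact mul_le_mul_of_nonneg_left (q_le_sqrt _) (Real.sqrt_nonneg _)
  unfold stepFun
  set y : ℝ := β * (⌈x / β⌉₊ : ℝ)
  have hy : 0 < y := hx.trans_le hy0
  have hB := (bose_pos hy).le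
  rw [Real.norm_of_nonneg (by positivity)]
  have e1 : Real.sqrt y * bose y ≤ x ^ (-(1 / 2) : ℝ) * (Real.exp (-(y / 4)) *
      Real.exp (-(1 / 4) * x)) := by
    have h1 := mul_bose_le hy
    have h2 : Real.sqrt y * bose y = y ^ (-(1 / 2) : ℝ) * (y * bose y) := by
      rw [← mul_assoc, Real.sqrt_eq_rpow]
      congr 1
      nth_rewrite 3 [← Real.rpow_one y]
      rw [← Real.rpow_add hy]; norm_num
    rw [h2]
    have h3 : y ^ (-(1 / 2) : ℝ) ≤ x ^ (-(1 / 2) : ℝ) :=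
      Real.rpow_le_rpow_of_nonpos hx hy0 (by norm_num)
    have h4 : y * bose y ≤ Real.exp (-(y / 4)) * Real.exp (-(1 / 4) * x) := by
      refine h1.trans ?_
      rw [← Real.exp_add]
      exact Real.exp_le_exp.mpr (by linarith)
    exact mul_le_mul h3 h4 (by positivity) (by positivity)
  calc y ^ p * (Real.sqrt β * q ⌈x / β⌉₊) * bose y
      ≤ y ^ p * Real.sqrt y * bose y := by gcongr
    _ = y ^ p * (Real.sqrt y * bose y) := by ring
    _ ≤ y ^ p * (x ^ (-(1 / 2) : ℝ) * (Real.exp (-(y / 4)) * Real.exp (-(1 / 4) * x))) := by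
        gcongr
    _ = (y ^ p * Real.exp (-(y / 4))) * (x ^ (-(1 / 2) : ℝ) * Real.exp (-(1 / 4) * x)) := by ring
    _ ≤ _ := by
        refine mul_le_mul_of_nonneg_right (pow_mul_exp_neg_le p hy.le) (by positivity)

theorem integrableOn_stepBound (C : ℝ) :
    IntegrableOn (fun x : ℝ => C * (x ^ (-(1 / 2) : ℝ) * Real.exp (-(1 / 4) * x))) (Ioi 0) := by
  have h := integrableOn_rpow_mul_exp_neg_mul_rpow (s := -(1 / 2)) (p := 1) (b := 1 / 4)
    (by norm_num) one_pos (by norm_num)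
  simp only [Real.rpow_one] at h
  exact h.const_mul C

theorem integral_stepFun (p : ℕ) {β : ℝ} (hβ : 0 < β) :
    ∫ x in Ioi (0 : ℝ), stepFun p β x = β ^ ((p : ℝ) + 3 / 2) * mom p β := by
  have hint : IntegrableOn (stepFun p β) (Ioi 0) := by
    refine Integrable.mono' (integrableOn_stepBound (4 ^ p * p.factorial))
      (measurable_stepFun p β).aestronglyMeasurable ?_
    filter_upwards [ae_restrict_mem measurableSet_Ioi] with x hx
    exact norm_stepFun_le p hβ hx
  have hU : Ioi (0 : ℝ) = ⋃ i : ℕ, Ioc (β * i) (β * (i + 1 : ℕ)) := by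
    ext x
    simp only [mem_Ioi, mem_iUnion, mem_Ioc]
    constructor
    · intro hx
      have hc : 0 < ⌈x / β⌉₊ := Nat.ceil_pos.mpr (div_pos hx hβ)
      refine ⟨⌈x / β⌉₊ - 1, ?_, ?_⟩
      · have := mul_ceil_lt hβ hx
        rw [Nat.cast_sub hc]
        push_cast
        linarith
      · rw [Nat.sub_add_cancel hc]; exact le_mul_ceil hβ
    · rintro ⟨i, h, -⟩
      exact lt_of_le_of_lt (by positivity) h
  have hd : Pairwise (Function.onFun Disjoint fun i : ℕ => Ioc (β * i) (β * (i + 1 : ℕ))) := by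
    have hm : Monotone fun i : ℕ => β * (i : ℝ) := fun a b h => by
      have : (a : ℝ) ≤ b := by exact_mod_cast h
      exact mul_le_mul_of_nonneg_left this hβ.le
    exact hm.pairwise_disjoint_on_Ioc_succ
  have h := hasSum_integral_iUnion (μ := volume) (f := stepFun p β)
    (fun i : ℕ => measurableSet_Ioc (a := β * (i : ℝ)) (b := β * ((i + 1 : ℕ) : ℝ))) hd
    (by rw [← hU]; exact hint)
  rw [← hU] at h
  rw [← h.tsum_eq, mom, ← tsum_mul_left]
  refine tsum_congr fun i => ?_
  have hconst : ∀ x ∈ Ioc (β * (i : ℝ)) (β * ((i + 1 : ℕ) : ℝ)), stepFun p β x =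
      (β * ((i + 1 : ℕ) : ℝ)) ^ p * (Real.sqrt β * q (i + 1)) * bose (β * ((i + 1 : ℕ) : ℝ)) := by
    intro x hx
    have hc : ⌈x / β⌉₊ = i + 1 := by
      rw [Nat.ceil_eq_iff (Nat.succ_ne_zero i)]
      refine ⟨?_, (div_le_iff₀' hβ).mpr hx.2⟩
      rw [lt_div_iff₀' hβ]
      simpa using hx.1
    rw [stepFun, hc]
  rw [setIntegral_congr_fun measurableSet_Ioc hconst, setIntegral_const, Real.volume_real_Ioc,
    max_eq_left (by push_cast; linarith), smul_eq_mul, momTerm]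
  have e : β ^ ((p : ℝ) + 3 / 2) = β ^ p * (Real.sqrt β * β) := by
    rw [Real.sqrt_eq_rpow, ← Real.rpow_natCast β p]
    nth_rewrite 4 [← Real.rpow_one β]
    rw [← Real.rpow_add hβ, ← Real.rpow_add hβ]
    norm_num
  rw [e, mul_pow]
  push_cast
  ring

theorem tendsto_mul_ceil {x : ℝ} (hx : 0 < x) :
    Tendsto (fun β : ℝ => β * (⌈x / β⌉₊ : ℝ)) (𝓝[>] 0) (𝓝 x) := by
  have h : Tendsto (fun β : ℝ => x + β) (𝓝[>] 0) (𝓝 x) := by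
    have : Tendsto (fun β : ℝ => x + β) (𝓝 0) (𝓝 (x + 0)) := tendsto_const_nhds.add tendsto_id
    rw [add_zero] at this
    exact this.mono_left nhdsWithin_le_nhds
  refine tendsto_of_tendsto_of_tendsto_of_le_of_le' tendsto_const_nhds h ?_ ?_
  · filter_upwards [self_mem_nhdsWithin] with β hβ using le_mul_ceil hβ
  · filter_upwards [self_mem_nhdsWithin] with β hβ using (mul_ceil_lt hβ hx).le

theorem tendsto_stepFun (p : ℕ) {x : ℝ} (hx : 0 < x) :
    Tendsto (fun β : ℝ => stepFun p β x) (𝓝[>] 0) (𝓝 (x ^ p * Real.sqrt x * bose x)) := by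
  have h1 := tendsto_mul_ceil hx
  have hs : Tendsto (fun β : ℝ => Real.sqrt (β * (⌈x / β⌉₊ : ℝ))) (𝓝[>] 0) (𝓝 (Real.sqrt x)) :=
    (Real.continuous_sqrt.tendsto x).comp h1
  have h0 : Tendsto (fun β : ℝ => Real.sqrt β) (𝓝[>] 0) (𝓝 0) := by
    have := (Real.continuous_sqrt.tendsto 0).mono_left (nhdsWithin_le_nhds (s := Ioi (0 : ℝ)))
    rwa [Real.sqrt_zero] at this
  have hl := hs.sub h0
  rw [sub_zero] at hl
  have hq : Tendsto (fun β : ℝ => Real.sqrt β * q ⌈x / β⌉₊) (𝓝[>] 0) (𝓝 (Real.sqrt x)) := by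
    refine tendsto_of_tendsto_of_tendsto_of_le_of_le' hl hs ?_ ?_
    · filter_upwards [self_mem_nhdsWithin] with β hβ
      have : Real.sqrt (⌈x / β⌉₊ : ℝ) ≤ q ⌈x / β⌉₊ + 1 := (Nat.lt_floor_add_one _).le
      rw [Real.sqrt_mul (le_of_lt hβ)]
      nlinarith [Real.sqrt_nonneg β]
    · filter_upwards [self_mem_nhdsWithin] with β hβ
      rw [Real.sqrt_mul (le_of_lt hβ)]
      exact mul_le_mul_of_nonneg_left (q_le_sqrt _) (Real.sqrt_nonneg _)
  have hb : ContinuousAt bose x := by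
    unfold bose
    exact ContinuousAt.inv₀ (by fun_prop) (sub_pos.mpr (Real.one_lt_exp_iff.mpr hx)).ne'
  exact ((h1.pow p).mul hq).mul (hb.tendsto.comp h1)

/-- The moments are Riemann sums of Bose integrals with mesh `β`. -/
theorem tendsto_mom (p : ℕ) :
    Tendsto (fun β : ℝ => β ^ ((p : ℝ) + 3 / 2) * mom p β) (𝓝[>] 0) (𝓝 (boseConst p)) := by
  have h : Tendsto (fun β : ℝ => ∫ x in Ioi (0 : ℝ), stepFun p β x) (𝓝[>] 0)
      (𝓝 (∫ x in Ioi (0 : ℝ), x ^ p * Real.sqrt x * bose x)) := by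
    refine tendsto_integral_filter_of_dominated_convergence _
      (Eventually.of_forall fun β => (measurable_stepFun p β).aestronglyMeasurable) ?_
      (integrableOn_stepBound (4 ^ p * p.factorial)) ?_
    · filter_upwards [self_mem_nhdsWithin] with β hβ
      filter_upwards [ae_restrict_mem measurableSet_Ioi] with x hx
      exact norm_stepFun_le p hβ hx
    · filter_upwards [ae_restrict_mem measurableSet_Ioi] with x hx
      exact tendsto_stepFun p hx
  rw [integral_bose] at h
  refine h.congr' ?_
  filter_upwards [self_mem_nhdsWithin] with β hβ using integral_stepFun p hβ

theorem boseConst_pos (p : ℕ) : 0 < boseConst p := by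
  have hs : (1 : ℝ) < (p : ℝ) + 3 / 2 := by
    have : (0 : ℝ) ≤ p := Nat.cast_nonneg p
    linarith
  refine mul_pos (Real.Gamma_pos_of_pos (by linarith)) ?_
  have e : (p : ℂ) + 3 / 2 = (((p : ℝ) + 3 / 2 : ℝ) : ℂ) := by push_cast; ring
  have h : riemannZeta ((p : ℂ) + 3 / 2) =
      ((∑' n : ℕ, 1 / ((n : ℝ) + 1) ^ ((p : ℝ) + 3 / 2) : ℝ) : ℂ) := by
    rw [e, zeta_eq_tsum_one_div_nat_add_one_cpow (by simpa using hs), Complex.ofReal_tsum]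
    refine tsum_congr fun n => ?_
    rw [Complex.ofReal_div, Complex.ofReal_cpow (by positivity)]
    push_cast; rfl
  rw [h, Complex.ofReal_re]
  have hsum : Summable fun n : ℕ => 1 / ((n : ℝ) + 1) ^ ((p : ℝ) + 3 / 2) := by
    simpa using (summable_nat_add_iff 1).mpr (Real.summable_one_div_nat_rpow.mpr hs)
  exact hsum.tsum_pos (fun n => by positivity) 0 (by positivity)

/-- `β(M) → 0`: the moment `mom 1` is decreasing and takes the value `M` at `β(M)`. -/
theorem tendsto_root : Tendsto root atTop (𝓝[>] 0) := by
  refine tendsto_nhdsWithin_iff.mpr ⟨?_, ?_⟩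
  · refine Metric.tendsto_atTop.mpr fun δ hδ => ?_
    refine ⟨⌈mom 1 δ⌉₊ + 1, fun M hM => ?_⟩
    have hM1 : 1 ≤ M := (Nat.le_add_left 1 _).trans hM
    rw [Real.dist_eq, sub_zero, abs_of_pos (root_pos hM1)]
    by_contra! h
    have h1 : mom 1 (root M) ≤ mom 1 δ := by
      rcases h.eq_or_lt with h | h
      · rw [h]
      · exact (mom_strictAnti 1 hδ h).le
    rw [mom_one_root hM1] at h1
    have h2 : (M : ℝ) ≤ ⌈mom 1 δ⌉₊ := h1.trans (Nat.le_ceil _)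
    have h3 : M ≤ ⌈mom 1 δ⌉₊ := by exact_mod_cast h2
    omega
  · filter_upwards [eventually_ge_atTop 1] with M hM using root_pos hM

theorem tendsto_root_rpow_mul_Ncr :
    Tendsto (fun M : ℕ => root M ^ (3 / 2 : ℝ) * Ncr M) atTop (𝓝 (boseConst 0)) := by
  have h := (tendsto_mom 0).comp tendsto_root
  simpa [Function.comp_def, Ncr_eq] using h

theorem tendsto_root_rpow_mul_self :
    Tendsto (fun M : ℕ => root M ^ (5 / 2 : ℝ) * M) atTop (𝓝 (boseConst 1)) := by
  have h := (tendsto_mom 1).comp tendsto_root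
  refine h.congr' ?_
  filter_upwards [eventually_ge_atTop 1] with M hM
  rw [Function.comp, mom_one_root hM]
  norm_num

theorem tendsto_Ncr_div :
    Tendsto (fun M : ℕ => Ncr M / (M : ℝ) ^ (3 / 5 : ℝ)) atTop
      (𝓝 (boseConst 0 / boseConst 1 ^ (3 / 5 : ℝ))) := by
  have h := tendsto_root_rpow_mul_Ncr.div
    (tendsto_root_rpow_mul_self.rpow_const (p := 3 / 5) (Or.inr (by norm_num)))
    (Real.rpow_pos_of_pos (boseConst_pos 1) _).ne'
  refine h.congr' ?_
  filter_upwards [eventually_ge_atTop 1] with M hM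
  have hβ := root_pos hM
  have hp := Real.rpow_pos_of_pos hβ (3 / 2)
  rw [Pi.div_apply, Real.mul_rpow (by positivity) (by positivity), ← Real.rpow_mul hβ.le]
  norm_num
  exact mul_div_mul_left _ _ hp.ne'

theorem isEquivalent_Ncr :
    Asymptotics.IsEquivalent atTop Ncr
      (fun M : ℕ => (M : ℝ) ^ (3 / 5 : ℝ) *
        (Real.Gamma (3 / 2) * (riemannZeta (3 / 2)).re) /
          (Real.Gamma (5 / 2) * (riemannZeta (5 / 2)).re) ^ (3 / 5 : ℝ)) := by
  have e0 : Real.Gamma (3 / 2) * (riemannZeta (3 / 2)).re = boseConst 0 := by simp [boseConst]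
  have e1 : Real.Gamma (5 / 2) * (riemannZeta (5 / 2)).re = boseConst 1 := by
    simp only [boseConst, Nat.cast_one]; norm_num
  rw [e0, e1]
  have h0 := boseConst_pos 0
  have h1 := Real.rpow_pos_of_pos (boseConst_pos 1) (3 / 5)
  have hc : 0 < boseConst 0 / boseConst 1 ^ (3 / 5 : ℝ) := div_pos h0 h1
  refine Asymptotics.isEquivalent_of_tendsto_one ?_
  have h := tendsto_Ncr_div.div_const (boseConst 0 / boseConst 1 ^ (3 / 5 : ℝ))
  rw [div_self hc.ne'] at h
  refine h.congr' ?_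
  filter_upwards with M
  rw [Pi.div_apply, div_div, mul_div_assoc]

end RiemannSums

/-! ### Anticoncentration of sums of independent variables -/

section Anticoncentration

variable {ι : Type*} [Fintype ι] [DecidableEq ι]

/-- The configuration that agrees with `y` where `c` holds and with `x` elsewhere. -/
def mix (c : ι → Prop) [DecidablePred c] (x y : ι → ℕ) : ι → ℕ := fun i => if c i then y i else x i

theorem sum_prod_eq_one {s : ι → Finset ℕ} {p : ι → ℕ → ℝ} (h1 : ∀ i, ∑ k ∈ s i, p i k = 1) :
    ∑ x ∈ Fintype.piFinset s, ∏ i, p i (x i) = 1 := by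
  rw [← Finset.prod_univ_sum]
  exact Finset.prod_eq_one fun i _ => h1 i

theorem sum_prod_mul_apply {s : ι → Finset ℕ} {p : ι → ℕ → ℝ} (h1 : ∀ i, ∑ k ∈ s i, p i k = 1)
    (i : ι) (f : ℕ → ℝ) :
    ∑ x ∈ Fintype.piFinset s, (∏ l, p l (x l)) * f (x i) = ∑ k ∈ s i, p i k * f k := by
  have e : ∀ x : ι → ℕ, (∏ l, p l (x l)) * f (x i) =
      ∏ l, (p l (x l) * if l = i then f (x l) else 1) := by
    intro x
    rw [Finset.prod_mul_distrib, Finset.prod_ite_eq' Finset.univ i (fun l => f (x l))]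
    simp
  simp_rw [e]
  rw [← Finset.prod_univ_sum s fun l k => p l k * if l = i then f k else 1,
    Finset.prod_eq_single i]
  · simp
  · intro l _ hl
    simp [hl, h1]
  · simp

/-- Exchanging some coordinates of two independent copies does not change the joint law. -/
theorem sum_sum_mix {s : ι → Finset ℕ} {p : ι → ℕ → ℝ} (h1 : ∀ i, ∑ k ∈ s i, p i k = 1)
    (c : ι → Prop) [DecidablePred c] (g : (ι → ℕ) → ℝ) :
    ∑ x ∈ Fintype.piFinset s, ∑ y ∈ Fintype.piFinset s,
      (∏ i, p i (x i)) * (∏ i, p i (y i)) * g (mix c x y) =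
    ∑ z ∈ Fintype.piFinset s, (∏ i, p i (z i)) * g z := by
  have hmem : ∀ x ∈ Fintype.piFinset s, ∀ y ∈ Fintype.piFinset s,
      mix c x y ∈ Fintype.piFinset s := by
    intro x hx y hy
    rw [Fintype.mem_piFinset] at *
    intro i
    unfold mix
    split_ifs
    exacts [hy i, hx i]
  have hinv : ∀ x y : ι → ℕ, mix c (mix c x y) (mix c y x) = x := by
    intro x y
    funext i
    by_cases h : c i <;> simp [mix, h]
  have hprod : ∀ x y : ι → ℕ, (∏ i, p i (x i)) * (∏ i, p i (y i)) =
      (∏ i, p i (mix c x y i)) * (∏ i, p i (mix c y x i)) := by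
    intro x y
    rw [← Finset.prod_mul_distrib, ← Finset.prod_mul_distrib]
    refine Finset.prod_congr rfl fun i _ => ?_
    by_cases h : c i <;> simp [mix, h, mul_comm]
  calc _ = ∑ w ∈ Fintype.piFinset s ×ˢ Fintype.piFinset s,
        (∏ i, p i (w.1 i)) * (∏ i, p i (w.2 i)) * g (mix c w.1 w.2) := by
        rw [Finset.sum_product]
    _ = ∑ w ∈ Fintype.piFinset s ×ˢ Fintype.piFinset s,
        (∏ i, p i (w.1 i)) * (∏ i, p i (w.2 i)) * g w.1 := by
        refine Finset.sum_nbij' (fun w => (mix c w.1 w.2, mix c w.2 w.1))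
          (fun w => (mix c w.1 w.2, mix c w.2 w.1)) ?_ ?_ ?_ ?_ ?_
        · intro w hw
          rw [Finset.mem_product] at *
          exact ⟨hmem _ hw.1 _ hw.2, hmem _ hw.2 _ hw.1⟩
        · intro w hw
          rw [Finset.mem_product] at *
          exact ⟨hmem _ hw.1 _ hw.2, hmem _ hw.2 _ hw.1⟩
        · intro w _; simp [hinv]
        · intro w _; simp [hinv]
        · intro w _
          simp only
          rw [hprod w.1 w.2]
    _ = _ := by
        rw [Finset.sum_product]
        refine Finset.sum_congr rfl fun z _ => ?_
        have e : ∀ y : ι → ℕ, (∏ i, p i (z i)) * (∏ i, p i (y i)) * g z =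
            ((∏ i, p i (z i)) * g z) * ∏ i, p i (y i) := fun y => by ring
        simp_rw [e]
        rw [← Finset.mul_sum, sum_prod_eq_one h1, mul_one]

/-- A discrete intermediate value theorem. -/
theorem exists_abs_le_of_step {f : ℕ → ℝ} {b : ℝ} {T : ℕ} (h0 : f 0 < 0) (hT : 0 < f T)
    (hs : ∀ t < T, |f (t + 1) - f t| ≤ b) : ∃ t ∈ Finset.range (T + 1), |f t| ≤ b := by
  have hex : ∃ t, 0 ≤ f t := ⟨T, hT.le⟩
  classical
  have h1 := Nat.find_spec hex
  have h2 : Nat.find hex ≤ T := Nat.find_min' hex hT.le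
  have h3 : Nat.find hex ≠ 0 := fun h => by rw [h] at h1; linarith
  obtain ⟨t, ht⟩ := Nat.exists_eq_succ_of_ne_zero h3
  have h4 : f t < 0 := not_le.mp (Nat.find_min hex (m := t) (by omega))
  rw [ht] at h1 h2
  refine ⟨t + 1, by rw [Finset.mem_range]; omega, ?_⟩
  have h5 := (abs_le.mp (hs t h2)).2
  rw [abs_of_nonneg h1]
  linarith

/-- Passing from `x` to `y` one coordinate at a time, a sum of contributions of size at most `b`
has to meet the interval `[-b, b]` on its way from negative to positive values. -/
theorem exists_mix_abs_le {s : ι → Finset ℕ} {v : ι → ℕ → ℝ} {m : ℝ} {b : ℝ}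
    (hv : ∀ i, ∀ k ∈ s i, v i k ∈ Set.Icc 0 b) {x y : ι → ℕ} (hx : x ∈ Fintype.piFinset s)
    (hy : y ∈ Fintype.piFinset s) (hxm : ∑ i, v i (x i) - m < 0) (hym : 0 < ∑ i, v i (y i) - m) :
    ∃ t ∈ Finset.range (Fintype.card ι + 1),
      |∑ i, v i (mix (fun i => (Fintype.equivFin ι i : ℕ) < t) x y i) - m| ≤ b := by
  set e := Fintype.equivFin ι
  have hb : ∀ i, |v i (y i) - v i (x i)| ≤ b := by
    intro i
    have h1 := hv i _ (Fintype.mem_piFinset.mp hx i)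
    have h2 := hv i _ (Fintype.mem_piFinset.mp hy i)
    rw [abs_le]
    constructor <;> linarith [h1.1, h1.2, h2.1, h2.2]
  refine exists_abs_le_of_step (f := fun t => ∑ i, v i (mix (fun i => (e i : ℕ) < t) x y i) - m)
    ?_ ?_ ?_
  · simpa [mix] using hxm
  · simpa [mix] using hym
  · intro t ht
    have h : (∑ i, v i (mix (fun i => (e i : ℕ) < t + 1) x y i) - m) -
        (∑ i, v i (mix (fun i => (e i : ℕ) < t) x y i) - m) =
        v (e.symm ⟨t, ht⟩) (y (e.symm ⟨t, ht⟩)) - v (e.symm ⟨t, ht⟩) (x (e.symm ⟨t, ht⟩)) := by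
      rw [sub_sub_sub_cancel_right, ← Finset.sum_sub_distrib,
        Finset.sum_eq_single (e.symm ⟨t, ht⟩)]
      · simp [mix]
      · intro i _ hi
        have hne : (e i : ℕ) ≠ t := fun h => hi (by
          rw [Equiv.eq_symm_apply]; exact Fin.ext h)
        have hiff : (e i : ℕ) < t + 1 ↔ (e i : ℕ) < t := by omega
        simp [mix, hiff]
      · simp
    rw [h]
    exact hb _

/-- A centred variable bounded by `D b` that exceeds `b` in absolute value with probability at
least `1 / 2` is positive with probability at least `1 / (4 D)`: its positive part has mean at
least `b / 4`. -/
theorem quarter_le_sum_pos {α : Type*} {Ω : Finset α} {P Y : α → ℝ} {b D : ℝ} (hb : 0 < b)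
    (hP : ∀ x ∈ Ω, 0 ≤ P x) (h1 : ∑ x ∈ Ω, P x = 1) (hY0 : ∑ x ∈ Ω, P x * Y x = 0)
    (hD : ∀ x ∈ Ω, |Y x| ≤ D * b) (hsmall : ∑ x ∈ Ω with |Y x| ≤ b, P x ≤ 1 / 2) :
    1 / 4 ≤ D * ∑ x ∈ Ω with 0 < Y x, P x := by
  have hE : b / 2 ≤ ∑ x ∈ Ω, P x * |Y x| := by
    have h2 : ∑ x ∈ Ω, (P x * b - if |Y x| ≤ b then P x * b else 0) ≤ ∑ x ∈ Ω, P x * |Y x| := by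
      refine Finset.sum_le_sum fun x hx => ?_
      split_ifs with h
      · rw [sub_self]; exact mul_nonneg (hP x hx) (abs_nonneg _)
      · rw [sub_zero]; exact mul_le_mul_of_nonneg_left (not_le.mp h).le (hP x hx)
    rw [Finset.sum_sub_distrib, ← Finset.sum_filter, ← Finset.sum_mul, ← Finset.sum_mul, h1] at h2
    nlinarith
  -- twice the mean of the positive part of `Y`
  have h3 : ∑ x ∈ Ω, (P x * |Y x| + P x * Y x) ≤
      ∑ x ∈ Ω, if 0 < Y x then P x * (2 * (D * b)) else 0 := by
    refine Finset.sum_le_sum fun x hx => ?_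
    split_ifs with h
    · have := hD x hx
      rw [abs_of_pos h] at *
      nlinarith [hP x hx]
    · rw [abs_of_nonpos (not_lt.mp h)]; linarith
  rw [Finset.sum_add_distrib, hY0, ← Finset.sum_filter, ← Finset.sum_mul] at h3
  nlinarith

/-- A sum of `T` independent random variables with values in `[0, b]` lies within `b` of its mean
with probability at least `1 / (16 (T + 1) ^ 3)`. If it did not, it would be far above and far
below its mean with probability of order `1 / T` each, and passing from one value to the other
by resampling one variable at a time one would meet the window. -/
theorem anticoncentration {s : ι → Finset ℕ} {p v : ι → ℕ → ℝ} {b : ℝ} (hb : 0 < b)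
    (hp : ∀ i k, 0 ≤ p i k) (h1 : ∀ i, ∑ k ∈ s i, p i k = 1)
    (hv : ∀ i, ∀ k ∈ s i, v i k ∈ Set.Icc 0 b) :
    1 / (16 * ((Fintype.card ι : ℝ) + 1) ^ 3) ≤
      ∑ x ∈ Fintype.piFinset s with |∑ i, v i (x i) - ∑ i, ∑ k ∈ s i, p i k * v i k| ≤ b,
        ∏ i, p i (x i) := by
  set m : ℝ := ∑ i, ∑ k ∈ s i, p i k * v i k with hm
  set Ω := Fintype.piFinset s
  set P : (ι → ℕ) → ℝ := fun x => ∏ i, p i (x i) with hPdef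
  set Y : (ι → ℕ) → ℝ := fun x => ∑ i, v i (x i) - m with hYdef
  set D : ℝ := (Fintype.card ι : ℝ) + 1 with hDdef
  have hD1 : 1 ≤ D := by rw [hDdef]; linarith [Nat.cast_nonneg (α := ℝ) (Fintype.card ι)]
  change 1 / (16 * D ^ 3) ≤ ∑ x ∈ Ω with |Y x| ≤ b, P x
  have hP : ∀ x ∈ Ω, 0 ≤ P x := fun x _ => Finset.prod_nonneg fun i _ => hp i _
  have hP1 : ∑ x ∈ Ω, P x = 1 := sum_prod_eq_one h1
  have hY0 : ∑ x ∈ Ω, P x * Y x = 0 := by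
    simp only [hYdef, mul_sub, Finset.sum_sub_distrib, Finset.mul_sum]
    rw [← Finset.sum_mul, hP1, one_mul, Finset.sum_comm, sub_eq_zero]
    exact Finset.sum_congr rfl fun i _ => sum_prod_mul_apply h1 i (v i)
  have hmean : ∀ i, ∑ k ∈ s i, p i k * v i k ∈ Set.Icc 0 b := by
    intro i
    refine ⟨Finset.sum_nonneg fun k hk => mul_nonneg (hp i k) (hv i k hk).1, ?_⟩
    calc ∑ k ∈ s i, p i k * v i k ≤ ∑ k ∈ s i, p i k * b :=
          Finset.sum_le_sum fun k hk => mul_le_mul_of_nonneg_left (hv i k hk).2 (hp i k)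
      _ = b := by rw [← Finset.sum_mul, h1, one_mul]
  have hYD : ∀ x ∈ Ω, |Y x| ≤ D * b := by
    intro x hx
    simp only [hYdef, hm]
    rw [← Finset.sum_sub_distrib]
    refine (Finset.abs_sum_le_sum_abs _ _).trans ?_
    calc ∑ i, |v i (x i) - ∑ k ∈ s i, p i k * v i k| ≤ ∑ _i : ι, b := by
          refine Finset.sum_le_sum fun i _ => ?_
          have ha := hv i _ (Fintype.mem_piFinset.mp hx i)
          have hc := hmean i
          rw [abs_le]
          constructor <;> linarith [ha.1, ha.2, hc.1, hc.2]
      _ = Fintype.card ι * b := by simp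
      _ ≤ D * b := by rw [hDdef]; nlinarith
  have hD3 : 1 ≤ D ^ 3 := one_le_pow₀ hD1
  by_cases hsmall : ∑ x ∈ Ω with |Y x| ≤ b, P x ≤ 1 / 2
  swap
  · refine le_trans ?_ (not_le.mp hsmall).le
    rw [div_le_div_iff₀ (by positivity) (by positivity)]
    linarith
  have hpos := quarter_le_sum_pos hb hP hP1 hY0 hYD hsmall
  have hneg := quarter_le_sum_pos (Y := fun x => -Y x) hb hP hP1 (by simpa using hY0)
    (by simpa using hYD) (by simpa using hsmall)
  -- a union bound over the intermediate configurations of two independent copies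
  have key : (∑ x ∈ Ω with 0 < -Y x, P x) * (∑ y ∈ Ω with 0 < Y y, P y) ≤
      D * ∑ x ∈ Ω with |Y x| ≤ b, P x := by
    rw [Finset.sum_filter, Finset.sum_filter, Finset.sum_mul_sum]
    calc _ ≤ ∑ x ∈ Ω, ∑ y ∈ Ω, ∑ t ∈ Finset.range (Fintype.card ι + 1), P x * P y *
          (if |Y (mix (fun i => (Fintype.equivFin ι i : ℕ) < t) x y)| ≤ b then 1 else 0) := by
          refine Finset.sum_le_sum fun x hx => Finset.sum_le_sum fun y hy => ?_
          have hterm : ∀ t ∈ Finset.range (Fintype.card ι + 1), 0 ≤ P x * P y *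
              (if |Y (mix (fun i => (Fintype.equivFin ι i : ℕ) < t) x y)| ≤ b then (1 : ℝ)
                else 0) := fun t _ =>
            mul_nonneg (mul_nonneg (hP x hx) (hP y hy)) (by split_ifs <;> norm_num)
          by_cases hxn : 0 < -Y x
          swap
          · rw [if_neg hxn, zero_mul]; exact Finset.sum_nonneg hterm
          by_cases hyp : 0 < Y y
          swap
          · rw [if_neg hyp, mul_zero]; exact Finset.sum_nonneg hterm
          rw [if_pos hxn, if_pos hyp]
          obtain ⟨t, ht, hle⟩ := exists_mix_abs_le hv hx hy (m := m) (neg_pos.mp hxn) hyp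
          refine le_trans (le_of_eq ?_) (Finset.single_le_sum hterm ht)
          rw [if_pos hle, mul_one]
      _ = ∑ t ∈ Finset.range (Fintype.card ι + 1), ∑ x ∈ Ω, ∑ y ∈ Ω, P x * P y *
          (if |Y (mix (fun i => (Fintype.equivFin ι i : ℕ) < t) x y)| ≤ b then 1 else 0) := by
          rw [Finset.sum_comm]
          refine Eq.trans ?_ Finset.sum_comm
          rw [Finset.sum_comm]
          exact Finset.sum_congr rfl fun x _ => Finset.sum_comm
      _ = ∑ t ∈ Finset.range (Fintype.card ι + 1), ∑ x ∈ Ω with |Y x| ≤ b, P x := by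
          refine Finset.sum_congr rfl fun t _ => ?_
          rw [sum_sum_mix h1 (fun i => (Fintype.equivFin ι i : ℕ) < t)
            (fun z => if |Y z| ≤ b then 1 else 0), Finset.sum_filter]
          refine Finset.sum_congr rfl fun x _ => ?_
          split_ifs <;> simp [hPdef]
      _ = D * ∑ x ∈ Ω with |Y x| ≤ b, P x := by
          rw [Finset.sum_const, Finset.card_range, nsmul_eq_mul, hDdef]; push_cast; rfl
  have hmul : (1 / 4) * (1 / 4) ≤ (D * ∑ x ∈ Ω with 0 < -Y x, P x) *
      (D * ∑ y ∈ Ω with 0 < Y y, P y) :=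
    mul_le_mul hneg hpos (by norm_num) (le_trans (by norm_num) hneg)
  rw [div_le_iff₀ (by positivity)]
  have hD2 : 0 ≤ D * D := by positivity
  have := mul_le_mul_of_nonneg_left key hD2
  nlinarith

end Anticoncentration

/-! ### Counting allocations -/

theorem choose_add_le_mul (a k s : ℕ) :
    (a + (k + s)).choose a ≤ (a + k).choose a * (a + s).choose a := by
  induction a with
  | zero => simp
  | succ a ih =>
    have h : ∀ n, (a + 1 + n).choose (a + 1) * (a + 1) = (a + 1 + n) * (a + n).choose a := by
      intro n
      have := Nat.add_one_mul_choose_eq (a + n) a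
      rw [show a + 1 + n = a + n + 1 by ring]
      exact this.symm
    have h1 := h (k + s)
    have h2 := h k
    have h3 := h s
    refine Nat.le_of_mul_le_mul_right (c := (a + 1) * (a + 1)) ?_ (by positivity)
    calc (a + 1 + (k + s)).choose (a + 1) * ((a + 1) * (a + 1))
        = (a + 1) * (a + 1 + (k + s)) * (a + (k + s)).choose a := by
          rw [← mul_assoc, h1]; ring
      _ ≤ ((a + 1 + k) * (a + 1 + s)) * ((a + k).choose a * (a + s).choose a) := by
          refine Nat.mul_le_mul ?_ ih
          nlinarith [Nat.zero_le (k * s)]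
      _ = ((a + 1 + k) * (a + k).choose a) * ((a + 1 + s) * (a + s).choose a) := by ring
      _ = ((a + 1 + k).choose (a + 1) * (a + 1)) * ((a + 1 + s).choose (a + 1) * (a + 1)) := by
          rw [h2, h3]
      _ = _ := by ring

theorem choose_add_le_pow (a k : ℕ) : (a + k).choose a ≤ (k + 1) ^ a := by
  induction a with
  | zero => simp
  | succ a ih =>
    have h := Nat.add_one_mul_choose_eq (a + k) a
    refine Nat.le_of_mul_le_mul_right (c := a + 1) ?_ (by positivity)
    rw [show a + 1 + k = a + k + 1 by ring, ← h, pow_succ]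
    calc (a + k + 1) * (a + k).choose a ≤ ((k + 1) * (a + 1)) * (k + 1) ^ a := by
          refine Nat.mul_le_mul ?_ ih
          nlinarith [Nat.zero_le (k * a)]
      _ = _ := by ring

/-- The number of ways to put `k` indistinguishable balls into `c` compartments. -/
def stars (c k : ℕ) : ℕ := (c + k - 1).choose k

theorem stars_succ (a k : ℕ) : stars (a + 1) k = (a + k).choose a := by
  rw [stars, show a + 1 + k - 1 = a + k by omega]
  exact Nat.choose_symm_add.symm

theorem stars_pos {c : ℕ} (hc : 1 ≤ c) (k : ℕ) : 0 < stars c k :=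
  Nat.choose_pos (by omega)

theorem stars_add_le_mul {c : ℕ} (hc : 1 ≤ c) (k s : ℕ) :
    stars c (k + s) ≤ stars c k * stars c s := by
  obtain ⟨a, rfl⟩ := Nat.exists_eq_add_of_le' hc
  simp only [stars_succ]
  exact choose_add_le_mul a k s

theorem stars_mono {c : ℕ} (hc : 1 ≤ c) {k l : ℕ} (h : k ≤ l) : stars c k ≤ stars c l := by
  obtain ⟨a, rfl⟩ := Nat.exists_eq_add_of_le' hc
  simp only [stars_succ]
  exact Nat.choose_le_choose a (by omega)

theorem stars_le_pow {c : ℕ} (hc : 1 ≤ c) (k : ℕ) : stars c k ≤ (k + 1) ^ c := by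
  obtain ⟨a, rfl⟩ := Nat.exists_eq_add_of_le' hc
  rw [stars_succ]
  exact (choose_add_le_pow a k).trans (Nat.pow_le_pow_right (by omega) (by omega))

/-- The number of balls in the boxes `U_1, …, U_M`. -/
def excited (M : ℕ) (n : ℕ →₀ ℕ) : ℕ := ∑ i ∈ Finset.range M, n (i + 1)

/-- The energy `∑_{1 ≤ j ≤ M} j N_j`. -/
def energy (M : ℕ) (n : ℕ →₀ ℕ) : ℕ := ∑ i ∈ Finset.range M, (i + 1) * n (i + 1)

/-- The part of the weight that comes from the boxes `U_1, …, U_M`. -/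
noncomputable def excitedWeight (M : ℕ) (n : ℕ →₀ ℕ) : ℕ :=
  ∏ i ∈ Finset.range M, stars (q (i + 1)) (n (i + 1))

theorem sum_eq_of_support {M : ℕ} {n : ℕ →₀ ℕ} (h : n.support ⊆ Finset.range (M + 1)) :
    (n.sum fun _ k => k) = n 0 + excited M n := by
  rw [Finsupp.sum_of_support_subset n h _ (by simp), Finset.sum_range_succ', add_comm, excited]

theorem energy_eq_of_support {M : ℕ} {n : ℕ →₀ ℕ} (h : n.support ⊆ Finset.range (M + 1)) :
    (n.sum fun j k => j * k) = energy M n := by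
  rw [Finsupp.sum_of_support_subset n h _ (by simp), Finset.sum_range_succ', energy]
  simp

theorem weight_eq_of_support {M : ℕ} {n : ℕ →₀ ℕ} (q0 : ℕ)
    (h : n.support ⊆ Finset.range (M + 1)) :
    weight q0 n = stars q0 (n 0) * excitedWeight M n := by
  rw [weight, Finsupp.prod_of_support_subset n h _ (by simp), Finset.prod_range_succ', mul_comm]
  rfl

theorem support_subset_of_mem_configs {M N : ℕ} {n : ℕ →₀ ℕ} (h : n ∈ configs M N) :
    n.support ⊆ Finset.range (M + 1) := by
  intro j hj
  have b : j * n j ≤ M :=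
    (Finset.single_le_sum (f := fun i => i * n i) (fun _ _ => Nat.zero_le _) hj).trans h.2
  have c : 1 ≤ n j := Nat.one_le_iff_ne_zero.mpr (Finsupp.mem_support_iff.mp hj)
  exact Finset.mem_range.mpr (Nat.lt_succ_of_le ((Nat.le_mul_of_pos_right j c).trans b))

theorem add_excited_of_mem_configs {M N : ℕ} {n : ℕ →₀ ℕ} (h : n ∈ configs M N) :
    n 0 + excited M n = N := by
  rw [← sum_eq_of_support (support_subset_of_mem_configs h), h.1]

theorem energy_le_of_mem_configs {M N : ℕ} {n : ℕ →₀ ℕ} (h : n ∈ configs M N) :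
    energy M n ≤ M := by
  rw [← energy_eq_of_support (support_subset_of_mem_configs h)]; exact h.2

theorem mem_configs_of_support {M N : ℕ} {n : ℕ →₀ ℕ} (h : n.support ⊆ Finset.range (M + 1))
    (h1 : n 0 + excited M n = N) (h2 : energy M n ≤ M) : n ∈ configs M N :=
  ⟨(sum_eq_of_support h).trans h1, (energy_eq_of_support h).le.trans h2⟩

theorem excited_le_energy (M : ℕ) (n : ℕ →₀ ℕ) : excited M n ≤ energy M n :=
  Finset.sum_le_sum fun i _ => Nat.le_mul_of_pos_left _ (Nat.succ_pos i)

theorem excitedWeight_pos (M : ℕ) (n : ℕ →₀ ℕ) : 0 < excitedWeight M n :=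
  Finset.prod_pos fun i _ => stars_pos (one_le_q (Nat.le_add_left 1 i)) _

/-- The configuration with all balls in `U_0` is always allowed. -/
theorem single_mem_configs (M N : ℕ) : Finsupp.single 0 N ∈ configs M N := by
  simp [configs]

theorem weight_pos {q0 M N : ℕ} (hq : 1 ≤ q0) {n : ℕ →₀ ℕ} (h : n ∈ configs M N) :
    0 < weight q0 n := by
  rw [weight_eq_of_support q0 (support_subset_of_mem_configs h)]
  exact Nat.mul_pos (stars_pos hq _) (excitedWeight_pos M n)

theorem sum_weight_pos {q0 : ℕ} (hq : 1 ≤ q0) (M N : ℕ) :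
    (0 : ℝ) < ∑ n ∈ (configs_finite M N).toFinset, (weight q0 n : ℝ) :=
  Finset.sum_pos (fun n hn => by
      exact_mod_cast weight_pos hq ((configs_finite M N).mem_toFinset.mp hn))
    ⟨_, (configs_finite M N).mem_toFinset.mpr (single_mem_configs M N)⟩

theorem prob_add_prob_compl {q0 : ℕ} (hq : 1 ≤ q0) (M N : ℕ) (A : Set (ℕ →₀ ℕ)) :
    prob q0 M N A + prob q0 M N Aᶜ = 1 := by
  classical
  rw [prob, prob, ← add_div, div_eq_one_iff_eq (sum_weight_pos hq M N).ne']
  convert! Finset.sum_filter_add_sum_filter_not (configs_finite M N).toFinset (· ∈ A) _ using 2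
  simp

theorem prob_nonneg (q0 M N : ℕ) (A : Set (ℕ →₀ ℕ)) : 0 ≤ prob q0 M N A := by
  unfold prob; positivity

theorem prob_le_one {q0 : ℕ} (hq : 1 ≤ q0) (M N : ℕ) (A : Set (ℕ →₀ ℕ)) :
    prob q0 M N A ≤ 1 := by
  have := prob_add_prob_compl hq M N A
  linarith [prob_nonneg q0 M N Aᶜ]

open Classical in
/-- Up to a polynomial factor the box `U_0` may be ignored: `stars q0` is submultiplicative and
of polynomial growth, and at most `M` balls lie outside `U_0`. -/
theorem prob_le {q0 : ℕ} (hq : 1 ≤ q0) (M N : ℕ) (A : Set (ℕ →₀ ℕ)) :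
    prob q0 M N A ≤ ((M : ℝ) + 1) ^ q0 *
      ((∑ n ∈ (configs_finite M N).toFinset with n ∈ A, (excitedWeight M n : ℝ)) /
        ∑ n ∈ (configs_finite M N).toFinset, (excitedWeight M n : ℝ)) := by
  have hmem : ∀ n ∈ (configs_finite M N).toFinset, n ∈ configs M N :=
    fun n hn => (configs_finite M N).mem_toFinset.mp hn
  have hB : (0 : ℝ) < ∑ n ∈ (configs_finite M N).toFinset, (excitedWeight M n : ℝ) :=
    Finset.sum_pos (fun n _ => by exact_mod_cast excitedWeight_pos M n)
      ⟨_, (configs_finite M N).mem_toFinset.mpr (single_mem_configs M N)⟩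
  have hN : (0 : ℝ) < stars q0 N := by exact_mod_cast stars_pos hq N
  have hnum : ∑ n ∈ (configs_finite M N).toFinset with n ∈ A, (weight q0 n : ℝ) ≤
      stars q0 N * ∑ n ∈ (configs_finite M N).toFinset with n ∈ A, (excitedWeight M n : ℝ) := by
    rw [Finset.mul_sum]
    refine Finset.sum_le_sum fun n hn => ?_
    have hc := hmem n (Finset.mem_filter.mp hn).1
    rw [weight_eq_of_support q0 (support_subset_of_mem_configs hc)]
    have := add_excited_of_mem_configs hc
    exact_mod_cast Nat.mul_le_mul_right _ (stars_mono hq (by omega))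
  have hden : stars q0 N * ∑ n ∈ (configs_finite M N).toFinset, (excitedWeight M n : ℝ) ≤
      ((M : ℝ) + 1) ^ q0 * ∑ n ∈ (configs_finite M N).toFinset, (weight q0 n : ℝ) := by
    rw [Finset.mul_sum, Finset.mul_sum]
    refine Finset.sum_le_sum fun n hn => ?_
    have hc := hmem n hn
    rw [weight_eq_of_support q0 (support_subset_of_mem_configs hc)]
    have h1 := add_excited_of_mem_configs hc
    have h2 := (excited_le_energy M n).trans (energy_le_of_mem_configs hc)
    have h3 : stars q0 N ≤ (M + 1) ^ q0 * stars q0 (n 0) := by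
      calc stars q0 N ≤ stars q0 (n 0) * stars q0 (excited M n) := by
            rw [← h1]; exact stars_add_le_mul hq _ _
        _ ≤ stars q0 (n 0) * (M + 1) ^ q0 :=
            Nat.mul_le_mul_left _ ((stars_mono hq h2).trans (stars_le_pow hq M))
        _ = _ := mul_comm _ _
    have h4 := Nat.mul_le_mul_right (excitedWeight M n) h3
    rw [mul_assoc] at h4
    exact_mod_cast h4
  rw [prob, div_le_iff₀ (sum_weight_pos hq M N)]
  refine hnum.trans ?_
  rw [mul_div_assoc', div_mul_eq_mul_div, le_div_iff₀ hB]
  calc _ = (∑ n ∈ (configs_finite M N).toFinset with n ∈ A, (excitedWeight M n : ℝ)) *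
        (stars q0 N * ∑ n ∈ (configs_finite M N).toFinset, (excitedWeight M n : ℝ)) := by ring
    _ ≤ (∑ n ∈ (configs_finite M N).toFinset with n ∈ A, (excitedWeight M n : ℝ)) *
        (((M : ℝ) + 1) ^ q0 * ∑ n ∈ (configs_finite M N).toFinset, (weight q0 n : ℝ)) :=
        mul_le_mul_of_nonneg_left hden (Finset.sum_nonneg fun _ _ => Nat.cast_nonneg _)
    _ = _ := by ring

/-- The negative binomial series bounds its partial sums. -/
theorem sum_stars_mul_pow_le {c : ℕ} (hc : 1 ≤ c) {r : ℝ} (h0 : 0 ≤ r) (h1 : r < 1)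
    (s : Finset ℕ) : ∑ k ∈ s, (stars c k : ℝ) * r ^ k ≤ ((1 - r)⁻¹) ^ c := by
  obtain ⟨a, rfl⟩ := Nat.exists_eq_add_of_le' hc
  have h := hasSum_choose_mul_geometric_of_norm_lt_one a (r := r)
    (by rwa [Real.norm_of_nonneg h0])
  rw [one_div, ← inv_pow] at h
  refine le_trans (le_of_eq (Finset.sum_congr rfl fun k _ => ?_))
    (sum_le_hasSum s (fun k _ => by positivity) h)
  rw [stars_succ, add_comm]

/-- The generating function of the excited boxes dominates sums over configurations. -/
theorem sum_excitedWeight_mul_le (M N : ℕ) {r : ℕ → ℝ} (h0 : ∀ i, 0 ≤ r i) (h1 : ∀ i, r i < 1) :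
    ∑ n ∈ (configs_finite M N).toFinset,
      (excitedWeight M n : ℝ) * ∏ i ∈ Finset.range M, r i ^ n (i + 1) ≤
    ∏ i ∈ Finset.range M, ((1 - r i)⁻¹) ^ q (i + 1) := by
  set φ : (ℕ →₀ ℕ) → (Fin M → ℕ) := fun n i => n (i + 1)
  set F : (Fin M → ℕ) → ℝ := fun k => ∏ i : Fin M, (stars (q (i + 1)) (k i) : ℝ) * r i ^ k i
  -- `n 0` is determined by the other occupation numbers
  have hinj : Set.InjOn φ ((configs_finite M N).toFinset : Set (ℕ →₀ ℕ)) := by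
    intro n hn n' hn' h
    rw [Set.Finite.coe_toFinset] at hn hn'
    have hval : ∀ i < M, n (i + 1) = n' (i + 1) := fun i hi => congrFun h ⟨i, hi⟩
    have he : excited M n = excited M n' :=
      Finset.sum_congr rfl fun i hi => hval i (Finset.mem_range.mp hi)
    have e1 := add_excited_of_mem_configs hn
    have e2 := add_excited_of_mem_configs hn'
    ext j
    rcases j with _ | i
    · omega
    · by_cases hi : i < M
      · exact hval i hi
      · have hz : ∀ l ∈ configs M N, l (i + 1) = 0 := by
          intro l hl
          by_contra hne
          have := Finset.mem_range.mp
            (support_subset_of_mem_configs hl (Finsupp.mem_support_iff.mpr hne))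
          omega
        rw [hz n hn, hz n' hn']
  have hF : ∀ k, 0 ≤ F k := fun k => Finset.prod_nonneg fun i _ =>
    mul_nonneg (Nat.cast_nonneg _) (pow_nonneg (h0 _) _)
  calc _ = ∑ n ∈ (configs_finite M N).toFinset, F (φ n) := by
        refine Finset.sum_congr rfl fun n _ => ?_
        rw [excitedWeight, Nat.cast_prod, ← Finset.prod_mul_distrib, Finset.prod_range]
    _ = ∑ k ∈ (configs_finite M N).toFinset.image φ, F k := (Finset.sum_image hinj).symm
    _ ≤ ∑ k ∈ Fintype.piFinset fun _ : Fin M => Finset.range (N + 1), F k := by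
        refine Finset.sum_le_sum_of_subset_of_nonneg ?_ fun k _ _ => hF k
        intro k hk
        obtain ⟨n, hn, rfl⟩ := Finset.mem_image.mp hk
        rw [Fintype.mem_piFinset]
        intro i
        have h2 := add_excited_of_mem_configs ((configs_finite M N).mem_toFinset.mp hn)
        have h3 : n (i + 1) ≤ excited M n :=
          Finset.single_le_sum (f := fun i => n (i + 1)) (fun _ _ => Nat.zero_le _)
            (Finset.mem_range.mpr i.2)
        exact Finset.mem_range.mpr (by change n (i + 1) < N + 1; omega)
    _ = ∏ i : Fin M, ∑ k ∈ Finset.range (N + 1), (stars (q (i + 1)) k : ℝ) * r i ^ k :=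
        (Finset.prod_univ_sum (fun _ : Fin M => Finset.range (N + 1))
          fun i k => (stars (q (i + 1)) k : ℝ) * r i ^ k).symm
    _ ≤ ∏ i : Fin M, ((1 - r i)⁻¹) ^ q (i + 1) :=
        Finset.prod_le_prod (fun i _ => Finset.sum_nonneg fun k _ =>
            mul_nonneg (Nat.cast_nonneg _) (pow_nonneg (h0 _) _))
          fun i _ => sum_stars_mul_pow_le (one_le_q (Nat.le_add_left 1 _)) (h0 _) (h1 _) _
    _ = _ := (Finset.prod_range fun i => ((1 - r i)⁻¹) ^ q (i + 1)).symm

section Compartments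

/-- The compartments of the boxes `U_j` with `J < j ≤ M`; the first component is `j - 1`. -/
abbrev Compartment (J M : ℕ) : Type := Σ i : ↥(Finset.Ico J M), Fin (q (i + 1))

variable {J M : ℕ}

theorem sum_range_dite (F : ↥(Finset.Ico J M) → ℕ) :
    ∑ i ∈ Finset.range M, (if h : i ∈ Finset.Ico J M then F ⟨i, h⟩ else 0) = ∑ i, F i := by
  rw [← Finset.sum_subset (s₁ := Finset.Ico J M), ← Finset.sum_coe_sort]
  · exact Finset.sum_congr rfl fun i _ => by rw [dif_pos i.2]
  · intro i hi
    exact Finset.mem_range.mpr (Finset.mem_Ico.mp hi).2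
  · intro i _ hi
    rw [dif_neg hi]

/-- The occupation numbers of the boxes that belong to an occupation of compartments, with the
remaining ones of the `N` balls in `U_0`. -/
noncomputable def boxConfig (N : ℕ) (x : Compartment J M → ℕ) : ℕ →₀ ℕ :=
  Finsupp.onFinset (Finset.range (M + 1))
    (fun j => Nat.casesOn j (N - ∑ c, x c)
      fun i => if h : i ∈ Finset.Ico J M then ∑ c, x ⟨⟨i, h⟩, c⟩ else 0)
    (by
      rintro (_ | i) hj
      · simp
      · by_contra hn
        refine hj (dif_neg fun h => hn ?_)
        have := (Finset.mem_Ico.mp h).2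
        rw [Finset.mem_range]
        omega)

theorem boxConfig_zero (N : ℕ) (x : Compartment J M → ℕ) :
    boxConfig N x 0 = N - ∑ c, x c := rfl

theorem boxConfig_succ (N : ℕ) (x : Compartment J M → ℕ) (i : ℕ) :
    boxConfig N x (i + 1) = if h : i ∈ Finset.Ico J M then ∑ c, x ⟨⟨i, h⟩, c⟩ else 0 := rfl

theorem boxConfig_mem_configs {N : ℕ} {x : Compartment J M → ℕ}
    (hE : ∑ c : Compartment J M, ((c.1 : ℕ) + 1) * x c ≤ M) (hS : ∑ c, x c ≤ N) :
    boxConfig N x ∈ configs M N := by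
  refine mem_configs_of_support Finsupp.support_onFinset_subset ?_ ?_
  · have : excited M (boxConfig N x) = ∑ c, x c := by
      simp only [excited, boxConfig_succ]
      rw [sum_range_dite fun i => ∑ c, x ⟨i, c⟩, Fintype.sum_sigma]
    rw [this, boxConfig_zero]
    omega
  · refine le_trans (le_of_eq ?_) hE
    simp only [energy, boxConfig_succ, mul_dite, mul_zero]
    rw [sum_range_dite fun i => ((i : ℕ) + 1) * ∑ c, x ⟨i, c⟩, Fintype.sum_sigma]
    simp [Finset.mul_sum]

/-- At most `excitedWeight M n` occupations of compartments have the same box occupation numbers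
`n` (stars and bars). -/
theorem card_fiber_le (N : ℕ) (G : Finset (Compartment J M → ℕ)) (n : ℕ →₀ ℕ) :
    (G.filter fun x => boxConfig N x = n).card ≤ excitedWeight M n := by
  set H := Fintype.piFinset fun i : ↥(Finset.Ico J M) =>
    Finset.finsuppAntidiag (Finset.univ : Finset (Fin (q (i + 1)))) (n (i + 1))
  have h1 : (G.filter fun x => boxConfig N x = n).card ≤ H.card := by
    refine Finset.card_le_card_of_injOn
      (fun x i => Finsupp.equivFunOnFinite.symm fun c => x ⟨i, c⟩) ?_ ?_
    · intro x hx
      have hx' := (Finset.mem_filter.mp (Finset.mem_coe.mp hx)).2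
      rw [Finset.mem_coe, Fintype.mem_piFinset]
      intro i
      rw [Finset.mem_finsuppAntidiag]
      refine ⟨?_, Finset.subset_univ _⟩
      rw [← hx', boxConfig_succ, dif_pos i.2]
      rfl
    · intro x _ y _ h
      funext ⟨i, c⟩
      exact DFunLike.congr_fun (congrFun h i) c
  refine h1.trans ?_
  rw [Fintype.card_piFinset]
  simp only [Finset.card_finsuppAntidiag_nat_eq_choose, Finset.card_univ, Fintype.card_fin]
  change ∏ i : ↥(Finset.Ico J M), stars (q (i + 1)) (n (i + 1)) ≤ _
  rw [Finset.prod_coe_sort (Finset.Ico J M) fun i => stars (q (i + 1)) (n (i + 1))]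
  refine Finset.prod_le_prod_of_subset_of_one_le' ?_ fun i _ _ =>
    stars_pos (one_le_q (Nat.le_add_left 1 i)) _
  intro i hi
  exact Finset.mem_range.mpr (Finset.mem_Ico.mp hi).2

theorem card_le_sum_excitedWeight {N : ℕ} {G : Finset (Compartment J M → ℕ)}
    (hE : ∀ x ∈ G, ∑ c : Compartment J M, ((c.1 : ℕ) + 1) * x c ≤ M)
    (hS : ∀ x ∈ G, ∑ c, x c ≤ N) :
    G.card ≤ ∑ n ∈ (configs_finite M N).toFinset, excitedWeight M n := by
  classical
  rw [Finset.card_eq_sum_card_fiberwise (f := boxConfig N) (t := (configs_finite M N).toFinset)]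
  · exact Finset.sum_le_sum fun n _ => card_fiber_le N G n
  · intro x hx
    rw [Finset.mem_coe, Set.Finite.mem_toFinset]
    exact boxConfig_mem_configs (hE x hx) (hS x hx)

end Compartments

/-! ### Chernoff bounds -/

theorem inv_one_sub_le_exp {w : ℝ} (hw : |w| ≤ 1 / 2) : (1 - w)⁻¹ ≤ Real.exp (w + 2 * w ^ 2) := by
  have h := Real.abs_log_sub_add_sum_range_le (x := w) (by linarith) 1
  simp only [Finset.sum_range_one, zero_add, pow_one, Nat.cast_zero, div_one,
    Nat.reduceAdd, sq_abs] at h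
  have h1 : |w| ^ 2 / (1 - |w|) ≤ 2 * w ^ 2 := by
    rw [div_le_iff₀ (by linarith), sq_abs]
    nlinarith [sq_nonneg w]
  have hpos : 0 < 1 - w := by linarith [le_abs_self w]
  rw [← Real.exp_log (inv_pos.mpr hpos), Real.exp_le_exp, Real.log_inv]
  have h2 := (abs_le.mp (h.trans (by simpa using h1))).1
  linarith

/-- This follows from `x / (e^x - 1) ≤ e^{-x/2}`. -/
theorem sq_mul_bose_le {y : ℝ} (hy : 0 < y) : y ^ 2 * bose y ≤ 2 := by
  have h := mul_bose_le hy
  have h2 : y / 2 * Real.exp (-(y / 2)) ≤ 1 := by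
    rw [Real.exp_neg, ← div_eq_mul_inv, div_le_one (Real.exp_pos _)]
    linarith [Real.add_one_le_exp (y / 2)]
  nlinarith

/-- The moment generating function of a geometric variable of parameter `e^{-y}`, with its mean
`bose y`, is subgaussian of variance `O(y⁻²)` in the range `|t| ≤ y / 4`. -/
theorem inv_one_sub_exp_sub_le {y t : ℝ} (hy : 0 < y) (ht : |t| ≤ y / 4) (ht1 : |t| ≤ 1) :
    (1 - Real.exp (t - y))⁻¹ ≤
      (1 - Real.exp (-y))⁻¹ * Real.exp (t * bose y + 10 * t ^ 2 / y ^ 2) := by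
  have hb := bose_pos hy
  have hE : Real.exp y - 1 ≠ 0 := (sub_pos.mpr (Real.one_lt_exp_iff.mpr hy)).ne'
  set w : ℝ := (Real.exp t - 1) * bose y with hw
  have e : 1 - Real.exp (t - y) = (1 - Real.exp (-y)) * (1 - w) := by
    rw [hw, bose, sub_eq_add_neg t, Real.exp_add, Real.exp_neg]
    have := Real.exp_pos y
    field_simp
    ring
  have h1 := Real.abs_exp_sub_one_le ht1
  have h2 := Real.abs_exp_sub_one_sub_id_le ht1
  have hyb := mul_bose_le_one hy
  have hwabs : |w| ≤ 2 * |t| * bose y := by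
    rw [hw, abs_mul, abs_of_pos hb]
    exact mul_le_mul_of_nonneg_right h1 hb.le
  have hw2 : |w| ≤ 1 / 2 := by nlinarith
  have hlin : w ≤ t * bose y + t ^ 2 * bose y := by
    rw [hw]
    nlinarith [(abs_le.mp h2).2]
  have hsq : w ^ 2 ≤ 4 * t ^ 2 * bose y ^ 2 := by
    rw [← sq_abs w]
    calc |w| ^ 2 ≤ (2 * |t| * bose y) ^ 2 := pow_le_pow_left₀ (abs_nonneg _) hwabs 2
      _ = 4 * |t| ^ 2 * bose y ^ 2 := by ring
      _ = _ := by rw [sq_abs]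
  have hb1 : bose y ≤ 2 / y ^ 2 := by
    rw [le_div_iff₀ (by positivity), mul_comm]; exact sq_mul_bose_le hy
  have hb2 : bose y ^ 2 ≤ 1 / y ^ 2 := by
    rw [le_div_iff₀ (by positivity), ← mul_pow, mul_comm]
    exact pow_le_one₀ (by positivity) hyb
  rw [e, mul_inv]
  refine mul_le_mul_of_nonneg_left ((inv_one_sub_le_exp hw2).trans (Real.exp_le_exp.mpr ?_)) ?_
  · have h3 : t ^ 2 * (bose y + 8 * bose y ^ 2) ≤ t ^ 2 * (2 / y ^ 2 + 8 * (1 / y ^ 2)) := by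
      gcongr
    have h4 : t ^ 2 * (2 / y ^ 2 + 8 * (1 / y ^ 2)) = 10 * t ^ 2 / y ^ 2 := by ring
    nlinarith
  · exact inv_nonneg.mpr (sub_nonneg.mpr (Real.exp_le_one_iff.mpr (by linarith)))

/-- The constant `∑_{j ≥ 1} q_j / j ^ 2`, the limit as `β → 0` of `β²` times the variance of the
number of balls outside `U_0`. -/
noncomputable def varConst : ℝ := ∑' i : ℕ, (q (i + 1) : ℝ) / ((i + 1 : ℕ) : ℝ) ^ 2

theorem summable_varConst : Summable fun i : ℕ => (q (i + 1) : ℝ) / ((i + 1 : ℕ) : ℝ) ^ 2 := by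
  have h : Summable fun i : ℕ => 1 / ((i + 1 : ℕ) : ℝ) ^ (3 / 2 : ℝ) :=
    (summable_nat_add_iff (f := fun n : ℕ => 1 / (n : ℝ) ^ (3 / 2 : ℝ)) 1).mpr
      (Real.summable_one_div_nat_rpow.mpr (by norm_num))
  refine Summable.of_nonneg_of_le (fun i => by positivity) (fun i => ?_) h
  have hj : (0 : ℝ) < ((i + 1 : ℕ) : ℝ) := by positivity
  rw [div_le_div_iff₀ (by positivity) (by positivity)]
  have h1 := q_le_sqrt (i + 1)
  rw [Real.sqrt_eq_rpow] at h1
  calc _ ≤ ((i + 1 : ℕ) : ℝ) ^ (1 / 2 : ℝ) * ((i + 1 : ℕ) : ℝ) ^ (3 / 2 : ℝ) := by gcongr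
    _ = _ := by
      rw [← Real.rpow_add hj]; norm_num

theorem varConst_nonneg : 0 ≤ varConst := tsum_nonneg fun i => by positivity

/-- The partition function of the boxes with index in `s` (box `U_j` having index `j - 1`). -/
noncomputable def partition (β : ℝ) (s : Finset ℕ) : ℝ :=
  ∏ i ∈ s, ((1 - Real.exp (-(β * ((i + 1 : ℕ) : ℝ))))⁻¹) ^ q (i + 1)

theorem one_lt_inv_one_sub_exp {y : ℝ} (hy : 0 < y) : 1 < (1 - Real.exp (-y))⁻¹ := by
  have h : Real.exp (-y) < 1 := Real.exp_zero ▸ Real.exp_lt_exp.mpr (by linarith)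
  rw [one_lt_inv₀ (by linarith)]
  linarith [Real.exp_pos (-y)]

theorem partition_pos {β : ℝ} (hβ : 0 < β) (s : Finset ℕ) : 0 < partition β s :=
  Finset.prod_pos fun i _ => pow_pos (one_pos.trans (one_lt_inv_one_sub_exp (by positivity))) _

/-- A bound for the moment generating function of the number of balls in the boxes with index in
`s`, multiplied by the partition function. -/
theorem prod_tilted_le {β t : ℝ} (hβ : 0 < β) (hβ1 : β ≤ 1) (ht : |t| ≤ β / 4) (s : Finset ℕ) :
    ∏ i ∈ s, ((1 - Real.exp (t - β * ((i + 1 : ℕ) : ℝ)))⁻¹) ^ q (i + 1) ≤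
      partition β s * Real.exp (t * ∑ i ∈ s, momTerm 0 β i + varConst) := by
  have h1 : ∀ i : ℕ, (1 : ℝ) ≤ ((i + 1 : ℕ) : ℝ) := fun i => by
    exact_mod_cast Nat.le_add_left 1 i
  have hle : ∀ i : ℕ, β ≤ β * ((i + 1 : ℕ) : ℝ) := fun i => le_mul_of_one_le_right hβ.le (h1 i)
  have hpos : ∀ i : ℕ, 0 ≤ (1 - Real.exp (t - β * ((i + 1 : ℕ) : ℝ)))⁻¹ := fun i =>
    inv_nonneg.mpr (sub_nonneg.mpr (Real.exp_le_one_iff.mpr (by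
      linarith [le_abs_self t, hle i])))
  calc _ ≤ ∏ i ∈ s, ((1 - Real.exp (-(β * ((i + 1 : ℕ) : ℝ))))⁻¹) ^ q (i + 1) *
        Real.exp (t * momTerm 0 β i + (q (i + 1) : ℝ) / ((i + 1 : ℕ) : ℝ) ^ 2) := by
        refine Finset.prod_le_prod (fun i _ => pow_nonneg (hpos i) _) fun i _ => ?_
        have h2 := inv_one_sub_exp_sub_le (y := β * ((i + 1 : ℕ) : ℝ)) (t := t) (by positivity)
          (by linarith [hle i]) (by linarith)
        refine (pow_le_pow_left₀ (hpos i) h2 _).trans ?_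
        rw [mul_pow, ← Real.exp_nat_mul]
        refine mul_le_mul_of_nonneg_left (Real.exp_le_exp.mpr ?_)
          (pow_nonneg (one_pos.trans (one_lt_inv_one_sub_exp (by positivity))).le _)
        have h3 : 10 * t ^ 2 / (β * ((i + 1 : ℕ) : ℝ)) ^ 2 ≤ 1 / ((i + 1 : ℕ) : ℝ) ^ 2 := by
          have h4 : t ^ 2 ≤ (β / 4) ^ 2 := by
            rw [← sq_abs]; exact pow_le_pow_left₀ (abs_nonneg _) ht 2
          rw [div_le_div_iff₀ (by positivity) (by have := h1 i; positivity), mul_pow]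
          have h5 : 0 ≤ ((i + 1 : ℕ) : ℝ) ^ 2 := by positivity
          nlinarith [sq_nonneg β]
        have h6 := mul_le_mul_of_nonneg_left h3 (Nat.cast_nonneg (α := ℝ) (q (i + 1)))
        simp only [momTerm, pow_zero, one_mul]
        rw [mul_one_div] at h6
        rw [mul_add]
        linarith
    _ = partition β s * Real.exp (t * ∑ i ∈ s, momTerm 0 β i +
        ∑ i ∈ s, (q (i + 1) : ℝ) / ((i + 1 : ℕ) : ℝ) ^ 2) := by
        rw [Finset.prod_mul_distrib, ← Real.exp_sum, Finset.sum_add_distrib, Finset.mul_sum,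
          partition]
    _ ≤ _ := by
        refine mul_le_mul_of_nonneg_left (Real.exp_le_exp.mpr ?_) (partition_pos hβ s).le
        exact add_le_add_right (summable_varConst.sum_le_tsum s fun i _ => by positivity) _

/-- The tail over `j > M` is at most `1 / M` times the next moment. -/
theorem mom_sub_sum_le (p : ℕ) {β : ℝ} (hβ : 0 < β) {M : ℕ} (hM : 1 ≤ M) :
    mom p β - ∑ i ∈ Finset.range M, momTerm p β i ≤ mom (p + 1) β / M := by
  have hM0 : (0 : ℝ) < M := by exact_mod_cast hM
  have h1 := (summable_momTerm p hβ).sum_add_tsum_nat_add M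
  have h2 := (summable_momTerm (p + 1) hβ).sum_add_tsum_nat_add M
  have h3 : 0 ≤ ∑ i ∈ Finset.range M, momTerm (p + 1) β i :=
    Finset.sum_nonneg fun i _ => (momTerm_pos _ hβ i).le
  rw [le_div_iff₀ hM0, mom, mom, ← h1, ← h2, add_sub_cancel_left, ← tsum_mul_right]
  refine le_add_of_nonneg_of_le h3 (Summable.tsum_le_tsum (fun i => ?_)
    (((summable_nat_add_iff M).mpr (summable_momTerm p hβ)).mul_right _)
    ((summable_nat_add_iff M).mpr (summable_momTerm (p + 1) hβ)))
  have h4 : (M : ℝ) ≤ ((i + M + 1 : ℕ) : ℝ) := by exact_mod_cast (by omega)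
  have h5 := (momTerm_pos p hβ (i + M)).le
  calc momTerm p β (i + M) * M ≤ momTerm p β (i + M) * ((i + M + 1 : ℕ) : ℝ) := by gcongr
    _ = _ := by simp only [momTerm, pow_succ]; ring

theorem sum_momTerm_le (p : ℕ) {β : ℝ} (hβ : 0 < β) (s : Finset ℕ) :
    ∑ i ∈ s, momTerm p β i ≤ mom p β :=
  (summable_momTerm p hβ).sum_le_tsum s fun i _ => (momTerm_pos p hβ i).le

theorem sum_excitedWeight_mul_exp_le (M N : ℕ) {β t : ℝ} (hβ : 0 < β) (hβ1 : β ≤ 1)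
    (ht : |t| ≤ β / 4) :
    ∑ n ∈ (configs_finite M N).toFinset,
      (excitedWeight M n : ℝ) * Real.exp (t * excited M n - β * energy M n) ≤
    partition β (Finset.range M) *
      Real.exp (t * ∑ i ∈ Finset.range M, momTerm 0 β i + varConst) := by
  refine le_trans (le_of_eq ?_) ((sum_excitedWeight_mul_le M N
    (r := fun i => Real.exp (t - β * ((i + 1 : ℕ) : ℝ))) (fun i => (Real.exp_pos _).le)
    fun i => ?_).trans (prod_tilted_le hβ hβ1 ht _))
  · refine Finset.sum_congr rfl fun n _ => ?_
    congr 1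
    simp_rw [← Real.exp_nat_mul]
    rw [← Real.exp_sum]
    congr 1
    simp only [excited, energy, Nat.cast_sum, Nat.cast_mul, Finset.mul_sum]
    rw [← Finset.sum_sub_distrib]
    exact Finset.sum_congr rfl fun i _ => by ring
  · rw [← Real.exp_zero]
    refine Real.exp_lt_exp.mpr ?_
    have : (1 : ℝ) ≤ ((i + 1 : ℕ) : ℝ) := by exact_mod_cast Nat.le_add_left 1 i
    nlinarith [le_abs_self t]

open Classical in
/-- The total weight of the configurations whose number of excited balls is off by more than `D`
is exponentially smaller than `e^{β M}` times the partition function. -/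
theorem sum_deviating_le {M : ℕ} (hM : 1 ≤ M) (N : ℕ) (h1 : root M ≤ 1) (D : ℝ) :
    ∑ n ∈ (configs_finite M N).toFinset with
        n ∈ {n : ℕ →₀ ℕ | D < |(n 0 : ℝ) - ((N : ℝ) - Ncr M)|}, (excitedWeight M n : ℝ) ≤
      2 * Real.exp (varConst + 1) * Real.exp (root M * M) *
        partition (root M) (Finset.range M) * Real.exp (-(root M * D / 4)) := by
  set β := root M with hβdef
  have hβ : 0 < β := root_pos hM
  set R := ∑ i ∈ Finset.range M, momTerm 0 β i with hR
  have hR1 : R ≤ Ncr M := by rw [Ncr_eq]; exact sum_momTerm_le 0 hβ _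
  have hR2 : Ncr M - R ≤ 1 := by
    have h := mom_sub_sum_le 0 hβ hM
    rw [zero_add, mom_one_root hM, div_self (by exact_mod_cast (by omega : M ≠ 0))] at h
    rwa [Ncr_eq]
  have hZ := (partition_pos hβ (Finset.range M)).le
  have hup := sum_excitedWeight_mul_exp_le M N (t := β / 4) hβ h1 (by rw [abs_of_pos (by linarith)])
  have hdn := sum_excitedWeight_mul_exp_le M N (t := -(β / 4)) hβ h1
    (by rw [abs_neg, abs_of_pos (by linarith)])
  rw [← hR] at hup hdn
  have hpoint : ∀ n ∈ (configs_finite M N).toFinset,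
      (if n ∈ {n : ℕ →₀ ℕ | D < |(n 0 : ℝ) - ((N : ℝ) - Ncr M)|} then (excitedWeight M n : ℝ)
        else 0) ≤
      Real.exp (β * M - β / 4 * (Ncr M + D)) *
        ((excitedWeight M n : ℝ) * Real.exp (β / 4 * excited M n - β * energy M n)) +
      Real.exp (β * M + β / 4 * (Ncr M - D)) *
        ((excitedWeight M n : ℝ) * Real.exp (-(β / 4) * excited M n - β * energy M n)) := by
    intro n hn
    have hc := (configs_finite M N).mem_toFinset.mp hn
    have hE : (energy M n : ℝ) ≤ M := by exact_mod_cast energy_le_of_mem_configs hc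
    have hN : (n 0 : ℝ) + excited M n = N := by exact_mod_cast add_excited_of_mem_configs hc
    have hw : (0 : ℝ) ≤ excitedWeight M n := Nat.cast_nonneg _
    split_ifs with hdev
    swap
    · positivity
    rw [mul_left_comm, ← Real.exp_add, mul_left_comm, ← Real.exp_add, ← mul_add]
    refine le_mul_of_one_le_right hw ?_
    -- one of the two Chernoff factors is at least `1`, and so is `e ^ (β (M - E))`
    rw [Set.mem_ofPred_eq, lt_abs] at hdev
    have hEβ : 0 ≤ β * (M - energy M n) := mul_nonneg hβ.le (by linarith)
    rcases hdev with h | h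
    · have : 0 ≤ β / 4 * (Ncr M - D - excited M n) := mul_nonneg (by linarith) (by linarith)
      refine (Real.one_le_exp ?_).trans (le_add_of_nonneg_left (Real.exp_pos _).le)
      linarith
    · have : 0 ≤ β / 4 * (excited M n - Ncr M - D) := mul_nonneg (by linarith) (by linarith)
      refine (Real.one_le_exp ?_).trans (le_add_of_nonneg_right (Real.exp_pos _).le)
      linarith
  rw [Finset.sum_filter]
  refine (Finset.sum_le_sum hpoint).trans ?_
  rw [Finset.sum_add_distrib, ← Finset.mul_sum, ← Finset.mul_sum]
  have b1 : Real.exp (β * M - β / 4 * (Ncr M + D)) * (partition β (Finset.range M) *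
      Real.exp (β / 4 * R + varConst)) ≤ Real.exp (varConst + 1) * Real.exp (β * M) *
        partition β (Finset.range M) * Real.exp (-(β * D / 4)) := by
    rw [mul_left_comm, ← Real.exp_add, ← Real.exp_add,
      mul_comm (Real.exp (varConst + 1 + β * M)), mul_assoc, ← Real.exp_add]
    refine mul_le_mul_of_nonneg_left (Real.exp_le_exp.mpr ?_) hZ
    nlinarith
  have b2 : Real.exp (β * M + β / 4 * (Ncr M - D)) * (partition β (Finset.range M) *
      Real.exp (-(β / 4) * R + varConst)) ≤ Real.exp (varConst + 1) * Real.exp (β * M) *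
        partition β (Finset.range M) * Real.exp (-(β * D / 4)) := by
    rw [mul_left_comm, ← Real.exp_add, ← Real.exp_add,
      mul_comm (Real.exp (varConst + 1 + β * M)), mul_assoc, ← Real.exp_add]
    refine mul_le_mul_of_nonneg_left (Real.exp_le_exp.mpr ?_) hZ
    nlinarith
  have c1 := mul_le_mul_of_nonneg_left hup
    (Real.exp_pos (β * M - β / 4 * (Ncr M + D))).le
  have c2 := mul_le_mul_of_nonneg_left hdn
    (Real.exp_pos (β * M + β / 4 * (Ncr M - D))).le
  linarith

/-! ### The lower bound for the number of allocations -/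

theorem geom_exp_sum {y : ℝ} (hy : 0 < y) (n : ℕ) :
    ∑ k ∈ Finset.range n, Real.exp (-y) ^ k =
      (1 - Real.exp (-(y * n))) * (1 - Real.exp (-y))⁻¹ := by
  have h : Real.exp (-y) < 1 := Real.exp_zero ▸ Real.exp_lt_exp.mpr (by linarith)
  have e : Real.exp (-(y * n)) = Real.exp (-y) ^ n := by
    rw [← Real.exp_nat_mul]; congr 1; ring
  rw [e, geom_sum_eq h.ne, ← neg_sub, ← neg_sub 1 (Real.exp (-y)), neg_div_neg_eq, div_eq_mul_inv]

theorem sum_mul_geom (r : ℝ) (n : ℕ) :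
    (1 - r) * ∑ k ∈ Finset.range n, r ^ k * k = r * ∑ k ∈ Finset.range n, r ^ k - n * r ^ n := by
  induction n with
  | zero => simp
  | succ n ih =>
    rw [Finset.sum_range_succ, Finset.sum_range_succ, mul_add, ih]
    push_cast
    ring

/-- The mean of a geometric variable conditioned to be less than `n`. -/
theorem sum_mul_geom_exp {y : ℝ} (hy : 0 < y) {n : ℕ} (hn : 0 < n) :
    ∑ k ∈ Finset.range n, Real.exp (-y) ^ k * k =
      (∑ k ∈ Finset.range n, Real.exp (-y) ^ k) * (bose y - n * bose (y * n)) := by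
  have hn' : (0 : ℝ) < n := by exact_mod_cast hn
  have hr : Real.exp (-y) < 1 := Real.exp_zero ▸ Real.exp_lt_exp.mpr (by linarith)
  have h1 : 1 - Real.exp (-y) ≠ 0 := by linarith
  have e : Real.exp (-y) ^ n = Real.exp (-(y * n)) := by
    rw [← Real.exp_nat_mul]; congr 1; ring
  have hb : ∀ z : ℝ, 0 < z → bose z * (1 - Real.exp (-z)) = Real.exp (-z) := by
    intro z hz
    have h2 : Real.exp z - 1 ≠ 0 := (sub_pos.mpr (Real.one_lt_exp_iff.mpr hz)).ne'
    rw [bose, Real.exp_neg]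
    have := Real.exp_pos z
    field_simp
  have h := sum_mul_geom (Real.exp (-y)) n
  have hy1 := hb y hy
  have hy2 := hb (y * n) (by positivity)
  have hG : (1 - Real.exp (-y)) * ∑ k ∈ Finset.range n, Real.exp (-y) ^ k =
      1 - Real.exp (-(y * n)) := by
    rw [geom_exp_sum hy]; field_simp
  rw [e] at h
  refine mul_left_cancel₀ h1 (h.trans ?_)
  linear_combination (-∑ k ∈ Finset.range n, Real.exp (-y) ^ k) * hy1 + (n : ℝ) * hy2 +
    (n * bose (y * n)) * hG

theorem prod_compartment {J M : ℕ} (f : ℕ → ℝ) :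
    ∏ c : Compartment J M, f c.1 = ∏ i ∈ Finset.Ico J M, f i ^ q (i + 1) := by
  rw [Fintype.prod_sigma, ← Finset.prod_coe_sort (Finset.Ico J M) fun i => f i ^ q (i + 1)]
  simp

theorem sum_compartment {J M : ℕ} (f : ℕ → ℝ) :
    ∑ c : Compartment J M, f c.1 = ∑ i ∈ Finset.Ico J M, q (i + 1) * f i := by
  rw [Fintype.sum_sigma, ← Finset.sum_coe_sort (Finset.Ico J M) fun i => q (i + 1) * f i]
  simp

theorem card_compartment_le (J M : ℕ) : Fintype.card (Compartment J M) ≤ M ^ 2 := by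
  rw [Fintype.card_sigma]
  simp only [Fintype.card_fin]
  rw [Finset.sum_coe_sort (Finset.Ico J M) fun i => q (i + 1)]
  calc ∑ i ∈ Finset.Ico J M, q (i + 1) ≤ ∑ i ∈ Finset.Ico J M, M :=
        Finset.sum_le_sum fun i hi =>
          (q_le_self _).trans (Nat.succ_le_of_lt (Finset.mem_Ico.mp hi).2)
    _ = (M - J) * M := by simp
    _ ≤ M * M := Nat.mul_le_mul_right _ (Nat.sub_le M J)
    _ = M ^ 2 := (sq M).symm

theorem partition_range_eq {J M : ℕ} (h : J ≤ M) (β : ℝ) :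
    partition β (Finset.range M) = partition β (Finset.range J) * partition β (Finset.Ico J M) :=
  (Finset.prod_range_mul_prod_Ico _ h).symm

theorem partition_range_le {β : ℝ} (hβ : 0 < β) (hβ1 : β ≤ 1) (J : ℕ) :
    partition β (Finset.range J) ≤ (2 / β) ^ (J * J) := by
  have h2 : 1 ≤ 2 / β := by rw [one_le_div hβ]; linarith
  calc partition β (Finset.range J) ≤ ∏ _i ∈ Finset.range J, (2 / β) ^ J := by
        refine Finset.prod_le_prod (fun i _ => pow_nonneg
          (one_pos.trans (one_lt_inv_one_sub_exp (by positivity))).le _) fun i hi => ?_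
        have hj : (1 : ℝ) ≤ ((i + 1 : ℕ) : ℝ) := by exact_mod_cast Nat.le_add_left 1 i
        have h1 : (1 - Real.exp (-(β * ((i + 1 : ℕ) : ℝ))))⁻¹ ≤ 2 / β := by
          rw [← inv_div β 2]
          refine inv_anti₀ (by linarith) ?_
          have h3 : Real.exp (-(β * ((i + 1 : ℕ) : ℝ))) ≤ Real.exp (-β) :=
            Real.exp_le_exp.mpr (by nlinarith)
          have h4 : Real.exp (-β) ≤ 1 / (1 + β) := by
            rw [Real.exp_neg, one_div]
            exact inv_anti₀ (by linarith) (by linarith [Real.add_one_le_exp β])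
          have h5 : 1 / (1 + β) ≤ 1 - β / 2 := by
            rw [div_le_iff₀ (by linarith)]; nlinarith
          linarith
        calc _ ≤ (2 / β) ^ q (i + 1) := pow_le_pow_left₀
              (one_pos.trans (one_lt_inv_one_sub_exp (by positivity))).le h1 _
          _ ≤ (2 / β) ^ J := pow_le_pow_right₀ h2
              ((q_le_self _).trans (Nat.succ_le_of_lt (Finset.mem_range.mp hi)))
    _ = _ := by rw [Finset.prod_const, Finset.card_range, ← pow_mul]

/-- The energy of the first `J` boxes is at most `J² / β` on average. -/
theorem sum_momTerm_one_le {β : ℝ} (hβ : 0 < β) (J : ℕ) :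
    β * ∑ i ∈ Finset.range J, momTerm 1 β i ≤ (J : ℝ) ^ 2 := by
  rw [Finset.mul_sum]
  calc _ ≤ ∑ _i ∈ Finset.range J, (J : ℝ) := by
        refine Finset.sum_le_sum fun i hi => ?_
        have hq : (q (i + 1) : ℝ) ≤ J := by
          exact_mod_cast (q_le_self _).trans (Nat.succ_le_of_lt (Finset.mem_range.mp hi))
        have h1 := mul_bose_le_one (x := β * ((i + 1 : ℕ) : ℝ)) (by positivity)
        have h0 : (0 : ℝ) ≤ q (i + 1) := Nat.cast_nonneg _
        simp only [momTerm, pow_one]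
        nlinarith
    _ = _ := by simp [sq]

/-- The energy of the first `J` boxes is at least `J / (2 β)` on average. -/
theorem le_sum_momTerm_one {β : ℝ} (hβ : 0 < β) {J : ℕ} (hJ : β * J ≤ 1) :
    (J : ℝ) / 2 ≤ β * ∑ i ∈ Finset.range J, momTerm 1 β i := by
  rw [Finset.mul_sum]
  calc (J : ℝ) / 2 = ∑ _i ∈ Finset.range J, (1 / 2 : ℝ) := by simp; ring
    _ ≤ _ := by
        refine Finset.sum_le_sum fun i hi => ?_
        have hj : ((i + 1 : ℕ) : ℝ) ≤ J := by
          exact_mod_cast Nat.succ_le_of_lt (Finset.mem_range.mp hi)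
        have hq : (1 : ℝ) ≤ q (i + 1) := by exact_mod_cast one_le_q (Nat.le_add_left 1 i)
        have h1 := half_le_mul_bose (x := β * ((i + 1 : ℕ) : ℝ)) (by positivity)
          ((mul_le_mul_of_nonneg_left hj hβ.le).trans hJ)
        simp only [momTerm, pow_one]
        nlinarith

/-- The first `J` boxes contain about `√J / β` balls on average. -/
theorem le_sum_momTerm_zero {β : ℝ} (hβ : 0 < β) {J : ℕ} (hJ : β * J ≤ 1) :
    Real.sqrt J / 4 ≤ β * ∑ i ∈ Finset.range J, momTerm 0 β i := by
  rcases Nat.eq_zero_or_pos J with rfl | hJ0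
  · simp
  have hs : 0 < Real.sqrt J := Real.sqrt_pos.mpr (by exact_mod_cast hJ0)
  rw [Finset.mul_sum]
  calc Real.sqrt J / 4 = ∑ _i ∈ Finset.range J, 1 / (4 * Real.sqrt J) := by
        rw [Finset.sum_const, Finset.card_range, nsmul_eq_mul]
        have := Real.mul_self_sqrt (Nat.cast_nonneg (α := ℝ) J)
        field_simp
        linarith
    _ ≤ _ := by
        refine Finset.sum_le_sum fun i hi => ?_
        set j : ℝ := ((i + 1 : ℕ) : ℝ) with hjdef
        have hj0 : 0 < j := by positivity
        have hj : j ≤ J := by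
          rw [hjdef]
          exact_mod_cast Nat.succ_le_of_lt (Finset.mem_range.mp hi)
        have hq : Real.sqrt j / 2 ≤ q (i + 1) := sqrt_div_two_le_q (Nat.le_add_left 1 i)
        have h1 := half_le_mul_bose (x := β * j) (by positivity)
          ((mul_le_mul_of_nonneg_left hj hβ.le).trans hJ)
        have hb := bose_pos (x := β * j) (by positivity)
        have hsj : 0 < Real.sqrt j := Real.sqrt_pos.mpr hj0
        have hss : Real.sqrt j ≤ Real.sqrt J := Real.sqrt_le_sqrt hj
        have hmul := Real.mul_self_sqrt hj0.le
        have h2 : 1 / (4 * Real.sqrt J) ≤ 1 / (4 * Real.sqrt j) := by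
          refine one_div_le_one_div_of_le (by positivity) (by linarith)
        have h3 : 1 / (4 * Real.sqrt j) = Real.sqrt j / 2 * (1 / 2 / j) := by
          have e : Real.sqrt j / 2 * (1 / 2 / j) =
              Real.sqrt j / 2 * (1 / 2 / (Real.sqrt j * Real.sqrt j)) := by rw [hmul]
          rw [e]; field_simp; ring
        have h4 : 1 / 2 / j ≤ β * bose (β * j) := by
          rw [div_le_iff₀ hj0]; linarith
        simp only [momTerm, pow_zero, one_mul, ← hjdef]
        calc _ ≤ Real.sqrt j / 2 * (1 / 2 / j) := h3 ▸ h2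
          _ ≤ q (i + 1) * (β * bose (β * j)) := by gcongr
          _ = _ := by ring

section LowerBound

variable {J M : ℕ} {β b : ℝ}

/-- The occupation numbers `k` of a compartment of `U_j`, `j = i + 1`, with `j k ≤ b`. -/
noncomputable def truncRange (b : ℝ) (i : ℕ) : Finset ℕ :=
  Finset.range (⌊b / ((i + 1 : ℕ) : ℝ)⌋₊ + 1)

/-- The partition function of a truncated compartment. -/
noncomputable def truncSum (β b : ℝ) (i : ℕ) : ℝ :=
  ∑ k ∈ truncRange b i, Real.exp (-(β * ((i + 1 : ℕ) : ℝ))) ^ k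

theorem truncSum_pos (β b : ℝ) (i : ℕ) : 0 < truncSum β b i :=
  Finset.sum_pos (fun _ _ => pow_pos (Real.exp_pos _) _) ⟨0, by simp [truncRange]⟩

/-- The mean energy of a truncated compartment. -/
noncomputable def truncMean (β b : ℝ) (i : ℕ) : ℝ :=
  ∑ k ∈ truncRange b i, Real.exp (-(β * ((i + 1 : ℕ) : ℝ))) ^ k / truncSum β b i *
    (((i + 1 : ℕ) : ℝ) * k)

theorem mul_le_of_mem_truncRange (hb : 0 ≤ b) {i k : ℕ} (hk : k ∈ truncRange b i) :
    ((i + 1 : ℕ) : ℝ) * k ≤ b := by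
  have h1 : k ≤ ⌊b / ((i + 1 : ℕ) : ℝ)⌋₊ := Nat.lt_succ_iff.mp (Finset.mem_range.mp hk)
  have h2 : (k : ℝ) ≤ b / ((i + 1 : ℕ) : ℝ) :=
    (Nat.cast_le.mpr h1).trans (Nat.floor_le (by positivity))
  rwa [le_div_iff₀' (by positivity)] at h2

theorem lt_mul_card_truncRange (b : ℝ) (i : ℕ) :
    b < ((i + 1 : ℕ) : ℝ) * ((⌊b / ((i + 1 : ℕ) : ℝ)⌋₊ + 1 : ℕ) : ℝ) := by
  have := Nat.lt_floor_add_one (b / ((i + 1 : ℕ) : ℝ))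
  rw [div_lt_iff₀' (by positivity)] at this
  push_cast at *
  exact this

theorem truncMean_eq (hβ : 0 < β) (i : ℕ) :
    truncMean β b i = ((i + 1 : ℕ) : ℝ) * (bose (β * ((i + 1 : ℕ) : ℝ)) -
      ((⌊b / ((i + 1 : ℕ) : ℝ)⌋₊ + 1 : ℕ) : ℝ) * bose (β * ((i + 1 : ℕ) : ℝ) *
        ((⌊b / ((i + 1 : ℕ) : ℝ)⌋₊ + 1 : ℕ) : ℝ))) := by
  have h := sum_mul_geom_exp (y := β * ((i + 1 : ℕ) : ℝ)) (by positivity)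
    (Nat.succ_pos ⌊b / ((i + 1 : ℕ) : ℝ)⌋₊)
  have hG := truncSum_pos β b i
  have e : truncMean β b i = ((i + 1 : ℕ) : ℝ) * ((∑ k ∈ truncRange b i,
      Real.exp (-(β * ((i + 1 : ℕ) : ℝ))) ^ k * k) / truncSum β b i) := by
    rw [truncMean, Finset.sum_div, Finset.mul_sum]
    exact Finset.sum_congr rfl fun k _ => by ring
  rw [e, truncRange, h]
  congr 1
  exact mul_div_cancel_left₀ _ hG.ne'

theorem truncMean_le (hβ : 0 < β) (i : ℕ) :
    truncMean β b i ≤ ((i + 1 : ℕ) : ℝ) * bose (β * ((i + 1 : ℕ) : ℝ)) := by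
  rw [truncMean_eq hβ]
  refine mul_le_mul_of_nonneg_left (sub_le_self _ ?_) (by positivity)
  exact mul_nonneg (by positivity) (bose_pos (by positivity)).le

theorem le_truncMean (hβ : 0 < β) (i : ℕ) :
    ((i + 1 : ℕ) : ℝ) * bose (β * ((i + 1 : ℕ) : ℝ)) - Real.exp (-(β * b / 2)) / β ≤
      truncMean β b i := by
  rw [truncMean_eq hβ, mul_sub]
  refine sub_le_sub_left ?_ _
  have hX := lt_mul_card_truncRange b i
  set n : ℝ := ((⌊b / ((i + 1 : ℕ) : ℝ)⌋₊ + 1 : ℕ) : ℝ)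
  set j : ℝ := ((i + 1 : ℕ) : ℝ)
  have hn : 0 < n := by positivity
  have hj : 0 < j := by positivity
  rw [le_div_iff₀ hβ]
  calc j * (n * bose (β * j * n)) * β = (β * j * n) * bose (β * j * n) := by ring
    _ ≤ Real.exp (-(β * j * n / 2)) := mul_bose_le (by positivity)
    _ ≤ _ := Real.exp_le_exp.mpr (by nlinarith)

theorem le_truncSum (hβ : 0 < β) (i : ℕ) :
    (1 - Real.exp (-(β * b))) * (1 - Real.exp (-(β * ((i + 1 : ℕ) : ℝ))))⁻¹ ≤ truncSum β b i := by
  rw [truncSum, truncRange, geom_exp_sum (by positivity)]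
  refine mul_le_mul_of_nonneg_right (sub_le_sub_left (Real.exp_le_exp.mpr ?_) _)
    (one_pos.trans (one_lt_inv_one_sub_exp (by positivity))).le
  have := lt_mul_card_truncRange b i
  nlinarith

/-- Truncation costs at most half of the partition function, by Bernoulli's inequality. -/
theorem prod_truncSum_ge (hβ : 0 < β) (hb : 0 < b)
    (hTb : (M : ℝ) ^ 2 * Real.exp (-(β * b / 2)) ≤ 1 / 2) :
    partition β (Finset.Ico J M) / 2 ≤ ∏ c : Compartment J M, truncSum β b c.1 := by
  set x := Real.exp (-(β * b)) with hx
  have hx0 : 0 < x := Real.exp_pos _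
  have hx2 : x ≤ Real.exp (-(β * b / 2)) := Real.exp_le_exp.mpr (by nlinarith [mul_pos hβ hb])
  have hx1 : x ≤ 1 := Real.exp_le_one_iff.mpr (by nlinarith [mul_pos hβ hb])
  have hT : (Fintype.card (Compartment J M) : ℝ) ≤ (M : ℝ) ^ 2 := by
    exact_mod_cast card_compartment_le J M
  have hbern : 1 / 2 ≤ (1 - x) ^ Fintype.card (Compartment J M) := by
    have h := one_add_mul_le_pow (a := -x) (by linarith) (Fintype.card (Compartment J M))
    have h2 : (Fintype.card (Compartment J M) : ℝ) * x ≤ 1 / 2 :=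
      (mul_le_mul hT hx2 hx0.le (by positivity)).trans hTb
    rw [← sub_eq_add_neg] at h
    linarith
  have hZ := partition_pos hβ (Finset.Ico J M)
  calc partition β (Finset.Ico J M) / 2 ≤
        (1 - x) ^ Fintype.card (Compartment J M) * partition β (Finset.Ico J M) := by nlinarith
    _ = ∏ c : Compartment J M, ((1 - x) * (1 - Real.exp (-(β * ((c.1 + 1 : ℕ) : ℝ))))⁻¹) := by
        rw [Finset.prod_mul_distrib, Finset.prod_const, Finset.card_univ, partition,
          prod_compartment fun i => (1 - Real.exp (-(β * ((i + 1 : ℕ) : ℝ))))⁻¹]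
    _ ≤ _ := Finset.prod_le_prod (fun c _ => mul_nonneg (by linarith)
        (one_pos.trans (one_lt_inv_one_sub_exp (by positivity))).le) fun c _ => le_truncSum hβ _

/-- With the first `J` boxes empty, the number of balls exceeds its unrestricted mean only with
small probability. -/
theorem sum_excess_le (hβ : 0 < β) (hβ1 : β ≤ 1) (hJM : J ≤ M) (hJ : β * J ≤ 1) :
    ∑ x ∈ Fintype.piFinset (fun c : Compartment J M => truncRange b c.1) with
        ¬ (∑ c, (x c : ℝ) ≤ mom 0 β),
      ∏ c, Real.exp (-(β * ((c.1 + 1 : ℕ) : ℝ))) ^ x c ≤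
    partition β (Finset.Ico J M) * Real.exp (varConst - Real.sqrt J / 16) := by
  have hj1 : ∀ i : ℕ, β ≤ β * ((i + 1 : ℕ) : ℝ) := fun i =>
    le_mul_of_one_le_right hβ.le (by exact_mod_cast Nat.le_add_left 1 i)
  have hlt : ∀ i : ℕ, Real.exp (β / 4 - β * ((i + 1 : ℕ) : ℝ)) < 1 := fun i => by
    rw [← Real.exp_zero]
    exact Real.exp_lt_exp.mpr (by linarith [hj1 i])
  calc _ ≤ ∑ x ∈ Fintype.piFinset (fun c : Compartment J M => truncRange b c.1),
        Real.exp (-(β / 4 * mom 0 β)) *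
          ∏ c, Real.exp (β / 4 - β * ((c.1 + 1 : ℕ) : ℝ)) ^ x c := by
        rw [Finset.sum_filter]
        refine Finset.sum_le_sum fun x _ => ?_
        split_ifs with h
        · exact mul_nonneg (Real.exp_pos _).le (Finset.prod_nonneg fun c _ => by positivity)
        simp_rw [← Real.exp_nat_mul]
        rw [← Real.exp_sum, ← Real.exp_sum, ← Real.exp_add]
        refine Real.exp_le_exp.mpr ?_
        have e : ∑ c : Compartment J M, (x c : ℝ) * (β / 4 - β * ((c.1 + 1 : ℕ) : ℝ)) =
            β / 4 * ∑ c, (x c : ℝ) + ∑ c, (x c : ℝ) * -(β * ((c.1 + 1 : ℕ) : ℝ)) := by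
          rw [Finset.mul_sum, ← Finset.sum_add_distrib]
          exact Finset.sum_congr rfl fun c _ => by ring
        rw [e]
        nlinarith
    _ = Real.exp (-(β / 4 * mom 0 β)) * ∏ c : Compartment J M,
          ∑ k ∈ truncRange b c.1, Real.exp (β / 4 - β * ((c.1 + 1 : ℕ) : ℝ)) ^ k := by
        rw [← Finset.mul_sum, Finset.prod_univ_sum]
    _ ≤ Real.exp (-(β / 4 * mom 0 β)) * ∏ c : Compartment J M,
          (1 - Real.exp (β / 4 - β * ((c.1 + 1 : ℕ) : ℝ)))⁻¹ := by
        refine mul_le_mul_of_nonneg_left (Finset.prod_le_prod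
          (fun c _ => Finset.sum_nonneg fun k _ => by positivity) fun c _ => ?_)
          (Real.exp_pos _).le
        exact sum_le_hasSum _ (fun k _ => by positivity)
          (hasSum_geometric_of_lt_one (Real.exp_pos _).le (hlt _))
    _ ≤ Real.exp (-(β / 4 * mom 0 β)) * (partition β (Finset.Ico J M) *
          Real.exp (β / 4 * ∑ i ∈ Finset.Ico J M, momTerm 0 β i + varConst)) := by
        rw [prod_compartment fun i => (1 - Real.exp (β / 4 - β * ((i + 1 : ℕ) : ℝ)))⁻¹]
        refine mul_le_mul_of_nonneg_left (prod_tilted_le hβ hβ1 ?_ _) (Real.exp_pos _).le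
        rw [abs_of_pos (by linarith)]
    _ ≤ _ := by
        rw [mul_left_comm, ← Real.exp_add]
        refine mul_le_mul_of_nonneg_left (Real.exp_le_exp.mpr ?_) (partition_pos hβ _).le
        have h1 := sum_momTerm_le 0 hβ (Finset.range M)
        rw [← Finset.sum_range_add_sum_Ico _ hJM] at h1
        have h2 := le_sum_momTerm_zero hβ hJ
        nlinarith

/-- The mean energy of the truncated system. -/
noncomputable def truncEnergy (β b : ℝ) (J M : ℕ) : ℝ :=
  ∑ c : Compartment J M, truncMean β b c.1

theorem truncEnergy_le (hβ : 0 < β) (hJM : J ≤ M) (hJ : β * J ≤ 1) :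
    β * truncEnergy β b J M ≤ β * mom 1 β - J / 2 := by
  have h1 : truncEnergy β b J M ≤ ∑ i ∈ Finset.Ico J M, momTerm 1 β i := by
    rw [truncEnergy, sum_compartment fun i => truncMean β b i]
    refine Finset.sum_le_sum fun i _ => ?_
    have := mul_le_mul_of_nonneg_left (truncMean_le (b := b) hβ i)
      (Nat.cast_nonneg (α := ℝ) (q (i + 1)))
    refine this.trans (le_of_eq ?_)
    simp only [momTerm]; ring
  have h2 := sum_momTerm_le 1 hβ (Finset.range M)
  rw [← Finset.sum_range_add_sum_Ico _ hJM] at h2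
  have h3 := le_sum_momTerm_one hβ hJ
  nlinarith

theorem le_truncEnergy (hβ : 0 < β) (hM : 1 ≤ M) (hJM : J ≤ M)
    (hTb : (M : ℝ) ^ 2 * Real.exp (-(β * b / 2)) ≤ 1 / 2) {C : ℝ}
    (hC : β * mom 2 β ≤ C * M) :
    β * mom 1 β - (C + (J : ℝ) ^ 2 + 1) ≤ β * truncEnergy β b J M := by
  have hM0 : (0 : ℝ) < M := by exact_mod_cast hM
  have hT : (Fintype.card (Compartment J M) : ℝ) ≤ (M : ℝ) ^ 2 := by
    exact_mod_cast card_compartment_le J M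
  have h1 : ∑ i ∈ Finset.Ico J M, momTerm 1 β i -
      Fintype.card (Compartment J M) * (Real.exp (-(β * b / 2)) / β) ≤ truncEnergy β b J M := by
    have e : ∑ i ∈ Finset.Ico J M, momTerm 1 β i = ∑ c : Compartment J M,
        ((c.1 + 1 : ℕ) : ℝ) * bose (β * ((c.1 + 1 : ℕ) : ℝ)) := by
      rw [sum_compartment fun i => ((i + 1 : ℕ) : ℝ) * bose (β * ((i + 1 : ℕ) : ℝ))]
      refine Finset.sum_congr rfl fun i _ => ?_
      simp only [momTerm]; ring
    have e2 : (Fintype.card (Compartment J M) : ℝ) * (Real.exp (-(β * b / 2)) / β) =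
        ∑ _c : Compartment J M, Real.exp (-(β * b / 2)) / β := by simp
    rw [e, e2, ← Finset.sum_sub_distrib, truncEnergy]
    exact Finset.sum_le_sum fun c _ => le_truncMean hβ _
  have h2 : β * (Fintype.card (Compartment J M) * (Real.exp (-(β * b / 2)) / β)) ≤ 1 / 2 := by
    have : β * (Fintype.card (Compartment J M) * (Real.exp (-(β * b / 2)) / β)) =
        Fintype.card (Compartment J M) * Real.exp (-(β * b / 2)) := by field_simp
    rw [this]
    exact (mul_le_mul_of_nonneg_right hT (Real.exp_pos _).le).trans hTb
  have h3 := sum_momTerm_one_le hβ J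
  have h4 := mom_sub_sum_le 1 hβ hM
  rw [← Finset.sum_range_add_sum_Ico _ hJM] at h4
  have h5 : β * (mom (1 + 1) β / M) ≤ C := by
    rw [mul_div_assoc', div_le_iff₀ hM0]; exact hC
  nlinarith

open Classical in
/-- The lower bound for the number of allocations. Only those are counted that leave the first `J`
boxes empty, obey the truncation, have at most `N_cr` balls outside `U_0` and an energy within `b`
of the truncated mean `E0`; this window lies below `M`, and above `M - (C + J² + 1) / β - b`. -/
theorem le_sum_excitedWeight {N : ℕ} (hM : 1 ≤ M) (hJM : J ≤ M) (hβ : β = root M) (hβ1 : β ≤ 1)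
    (hJ : β * J ≤ 1) (hb : 0 < b) (hTb : (M : ℝ) ^ 2 * Real.exp (-(β * b / 2)) ≤ 1 / 2)
    (hbJ : β * b ≤ J / 2)
    (hS : Real.exp (varConst - Real.sqrt J / 16) ≤ 1 / (64 * ((M : ℝ) ^ 2 + 1) ^ 3))
    {C : ℝ} (hC : β * mom 2 β ≤ C * M) (hN : Ncr M < N) :
    Real.exp (β * M - (C + (J : ℝ) ^ 2 + 1 + β * b)) *
        (partition β (Finset.Ico J M) * (1 / (64 * ((M : ℝ) ^ 2 + 1) ^ 3))) ≤
      ∑ n ∈ (configs_finite M N).toFinset, (excitedWeight M n : ℝ) := by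
  have hβ0 : 0 < β := hβ ▸ root_pos hM
  have hmom : mom 1 β = M := hβ ▸ mom_one_root hM
  have hNcr : mom 0 β = Ncr M := by rw [Ncr_eq, hβ]
  set Ω := Fintype.piFinset (fun c : Compartment J M => truncRange b c.1) with hΩ
  set E0 := truncEnergy β b J M with hE0
  set E : (Compartment J M → ℕ) → ℝ := fun x => ∑ c, ((c.1 + 1 : ℕ) : ℝ) * x c with hE
  set ρ : (Compartment J M → ℕ) → ℝ :=
    fun x => ∏ c, Real.exp (-(β * ((c.1 + 1 : ℕ) : ℝ))) ^ x c with hρ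
  have hρ0 : ∀ x, 0 ≤ ρ x := fun x => Finset.prod_nonneg fun c _ => by positivity
  have hρE : ∀ x, ρ x = Real.exp (-(β * E x)) := by
    intro x
    simp only [hρ, hE]
    simp_rw [← Real.exp_nat_mul]
    rw [← Real.exp_sum, Finset.mul_sum, ← Finset.sum_neg_distrib]
    exact congrArg _ (Finset.sum_congr rfl fun c _ => by ring)
  have hZ := partition_pos hβ0 (Finset.Ico J M)
  have hM2 : (0 : ℝ) < 64 * ((M : ℝ) ^ 2 + 1) ^ 3 := by positivity
  -- the window around the mean energy carries a polynomial share of the weight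
  have hwin : partition β (Finset.Ico J M) * (1 / (32 * ((M : ℝ) ^ 2 + 1) ^ 3)) ≤
      ∑ x ∈ Ω with |E x - E0| ≤ b, ρ x := by
    have h := anticoncentration (ι := Compartment J M) (s := fun c => truncRange b c.1)
      (p := fun c k => Real.exp (-(β * ((c.1 + 1 : ℕ) : ℝ))) ^ k / truncSum β b c.1)
      (v := fun c k => ((c.1 + 1 : ℕ) : ℝ) * k) hb
      (fun c k => div_nonneg (by positivity) (truncSum_pos _ _ _).le)
      (fun c => by
        rw [← Finset.sum_div]
        exact div_self (truncSum_pos β b c.1).ne')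
      (fun c k hk => ⟨by positivity, mul_le_of_mem_truncRange hb.le hk⟩)
    have hW := prod_truncSum_ge (J := J) hβ0 hb hTb
    have hW0 : 0 < ∏ c : Compartment J M, truncSum β b c.1 :=
      Finset.prod_pos fun c _ => truncSum_pos _ _ _
    simp only [Finset.prod_div_distrib] at h
    rw [← Finset.sum_div, le_div_iff₀ hW0] at h
    refine le_trans ?_ h
    have hT : (Fintype.card (Compartment J M) : ℝ) ≤ (M : ℝ) ^ 2 := by
      exact_mod_cast card_compartment_le J M
    have hT3 : 1 / (16 * ((M : ℝ) ^ 2 + 1) ^ 3) ≤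
        1 / (16 * ((Fintype.card (Compartment J M) : ℝ) + 1) ^ 3) :=
      one_div_le_one_div_of_le (by positivity) (by gcongr)
    calc partition β (Finset.Ico J M) * (1 / (32 * ((M : ℝ) ^ 2 + 1) ^ 3))
        = 1 / (16 * ((M : ℝ) ^ 2 + 1) ^ 3) * (partition β (Finset.Ico J M) / 2) := by
          field_simp; norm_num
      _ ≤ _ := mul_le_mul hT3 hW (by positivity) (by positivity)
  set G := Ω.filter fun x => |E x - E0| ≤ b ∧ ∑ c, (x c : ℝ) ≤ mom 0 β with hG
  have hsplit : ∑ x ∈ Ω with |E x - E0| ≤ b, ρ x ≤ ∑ x ∈ G, ρ x +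
      ∑ x ∈ Ω with ¬ (∑ c, (x c : ℝ) ≤ mom 0 β), ρ x := by
    rw [hG, Finset.sum_filter, Finset.sum_filter, Finset.sum_filter, ← Finset.sum_add_distrib]
    refine Finset.sum_le_sum fun x _ => ?_
    by_cases h1 : |E x - E0| ≤ b <;> by_cases h2 : ∑ c, (x c : ℝ) ≤ mom 0 β <;>
      simp [h1, h2, hρ0]
  have hexc : ∑ x ∈ Ω with ¬ (∑ c, (x c : ℝ) ≤ mom 0 β), ρ x ≤
      partition β (Finset.Ico J M) * (1 / (64 * ((M : ℝ) ^ 2 + 1) ^ 3)) :=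
    (sum_excess_le hβ0 hβ1 hJM hJ).trans (mul_le_mul_of_nonneg_left hS hZ.le)
  have hGρ : partition β (Finset.Ico J M) * (1 / (64 * ((M : ℝ) ^ 2 + 1) ^ 3)) ≤
      ∑ x ∈ G, ρ x := by
    have e : partition β (Finset.Ico J M) * (1 / (32 * ((M : ℝ) ^ 2 + 1) ^ 3)) =
        2 * (partition β (Finset.Ico J M) * (1 / (64 * ((M : ℝ) ^ 2 + 1) ^ 3))) := by
      field_simp; norm_num
    linarith
  have hElow : β * M - (C + (J : ℝ) ^ 2 + 1) ≤ β * E0 := by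
    rw [← hmom]; exact le_truncEnergy hβ0 hM hJM hTb hC
  have hEup : E0 + b ≤ M := by
    have h := truncEnergy_le (b := b) (M := M) hβ0 hJM hJ
    rw [hmom] at h
    exact le_of_mul_le_mul_left (by rw [mul_add]; linarith) hβ0
  -- each allocation counts `1 = e ^ (β E) ρ`, and `E ≥ E0 - b`
  have hcard : Real.exp (β * M - (C + (J : ℝ) ^ 2 + 1 + β * b)) * ∑ x ∈ G, ρ x ≤ G.card := by
    rw [Finset.mul_sum, Finset.cast_card]
    refine Finset.sum_le_sum fun x hx => ?_
    have h := (abs_le.mp (Finset.mem_filter.mp hx).2.1).1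
    rw [hρE, ← Real.exp_add]
    refine Real.exp_le_one_iff.mpr ?_
    nlinarith
  have hGle : G.card ≤ ∑ n ∈ (configs_finite M N).toFinset, excitedWeight M n := by
    refine card_le_sum_excitedWeight (fun x hx => ?_) fun x hx => ?_
    · have h := (abs_le.mp (Finset.mem_filter.mp hx).2.1).2
      have h2 : E x ≤ M := by linarith
      simp only [hE] at h2
      exact_mod_cast h2
    · have h := (Finset.mem_filter.mp hx).2.2
      have h2 : ∑ c, (x c : ℝ) ≤ N := by linarith
      exact_mod_cast h2
  calc _ ≤ Real.exp (β * M - (C + (J : ℝ) ^ 2 + 1 + β * b)) * ∑ x ∈ G, ρ x :=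
        mul_le_mul_of_nonneg_left hGρ (Real.exp_pos _).le
    _ ≤ G.card := hcard
    _ ≤ _ := by exact_mod_cast hGle

end LowerBound

/-! ### The condensation estimate -/

theorem tendsto_log_atTop : Tendsto (fun M : ℕ => Real.log M) atTop atTop :=
  Real.tendsto_log_atTop.comp tendsto_natCast_atTop_atTop

theorem tendsto_root_mul_rpow :
    Tendsto (fun M : ℕ => root M * (M : ℝ) ^ (2 / 5 : ℝ)) atTop
      (𝓝 (boseConst 1 ^ (2 / 5 : ℝ))) := by
  refine (tendsto_root_rpow_mul_self.rpow_const (p := 2 / 5) (Or.inr (by norm_num))).congr' ?_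
  filter_upwards [eventually_ge_atTop 1] with M hM
  have hβ := root_pos hM
  rw [Real.mul_rpow (by positivity) (by positivity), ← Real.rpow_mul hβ.le]
  norm_num

theorem tendsto_log_sq_div_rpow (A : ℝ) {r : ℝ} (hr : 0 < r) :
    Tendsto (fun M : ℕ => ((A * Real.log M) ^ 2 + 1) / (M : ℝ) ^ r) atTop (𝓝 0) := by
  have h1 : Tendsto (fun x : ℝ => Real.log x ^ 2 / x ^ r) atTop (𝓝 0) := by
    have := (isLittleO_log_rpow_rpow_atTop (2 : ℝ) hr).tendsto_div_nhds_zero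
    simpa using this
  have h2 : Tendsto (fun x : ℝ => (x ^ r)⁻¹) atTop (𝓝 0) :=
    (tendsto_rpow_atTop hr).inv_tendsto_atTop
  have h := ((h1.const_mul (A ^ 2)).add h2).comp tendsto_natCast_atTop_atTop (α := ℕ)
  rw [mul_zero, add_zero] at h
  refine h.congr fun M => ?_
  simp only [Function.comp]
  ring

/-- `β` is of order `M ^ (-2 / 5)`. -/
theorem eventually_root_mul_log_sq_le (A : ℝ) :
    ∀ᶠ M : ℕ in atTop, root M * ((A * Real.log M) ^ 2 + 1) ≤ 1 := by
  have h := tendsto_root_mul_rpow.mul (tendsto_log_sq_div_rpow A (r := 2 / 5) (by norm_num))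
  rw [mul_zero] at h
  filter_upwards [h.eventually_le_const one_pos, eventually_ge_atTop 1] with M hM hM1
  have hp : (0 : ℝ) < (M : ℝ) ^ (2 / 5 : ℝ) := Real.rpow_pos_of_pos (by exact_mod_cast hM1) _
  rwa [mul_div_assoc', div_le_iff₀ hp, one_mul, mul_right_comm, mul_le_iff_le_one_left hp] at hM

theorem eventually_log_sq_le (A : ℝ) :
    ∀ᶠ M : ℕ in atTop, (A * Real.log M) ^ 2 + 1 ≤ M := by
  filter_upwards [(tendsto_log_sq_div_rpow A one_pos).eventually_le_const one_pos,
    eventually_ge_atTop 1] with M hM hM1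
  have hp : (0 : ℝ) < M := by exact_mod_cast hM1
  rwa [Real.rpow_one, div_le_one hp] at hM

theorem eventually_two_le_root_mul : ∀ᶠ M : ℕ in atTop, 2 ≤ root M * M := by
  have h : Tendsto (fun M : ℕ => (M : ℝ) ^ (3 / 5 : ℝ)) atTop atTop :=
    (tendsto_rpow_atTop (by norm_num)).comp tendsto_natCast_atTop_atTop
  have h2 := tendsto_root_mul_rpow.pos_mul_atTop (Real.rpow_pos_of_pos (boseConst_pos 1) _) h
  filter_upwards [h2.eventually_ge_atTop 2, eventually_ge_atTop 1] with M hM hM1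
  have hp : (0 : ℝ) < M := by exact_mod_cast hM1
  rw [mul_assoc, ← Real.rpow_add hp] at hM
  norm_num at hM
  exact hM

/-- The moment `mom 2` is of order `β ^ (-7 / 2)` and `M` of order `β ^ (-5 / 2)`. -/
theorem exists_root_mul_mom_two_le :
    ∃ C : ℝ, 0 ≤ C ∧ ∀ᶠ M : ℕ in atTop, root M * mom 2 (root M) ≤ C * M := by
  have h := ((tendsto_mom 2).comp tendsto_root).div tendsto_root_rpow_mul_self (boseConst_pos 1).ne'
  refine ⟨boseConst 2 / boseConst 1 + 1,
    by have := boseConst_pos 1; have := boseConst_pos 2; positivity, ?_⟩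
  filter_upwards [h.eventually_le_const (lt_add_one _), eventually_ge_atTop 1] with M hM hM1
  have hβ := root_pos hM1
  have hp : (0 : ℝ) < M := by exact_mod_cast hM1
  have h5 := Real.rpow_pos_of_pos hβ (5 / 2)
  have e : root M ^ (((2 : ℕ) : ℝ) + 3 / 2) = root M ^ (5 / 2 : ℝ) * root M := by
    nth_rewrite 3 [← Real.rpow_one (root M)]
    rw [← Real.rpow_add hβ]; norm_num
  rw [Pi.div_apply, Function.comp, e, mul_assoc, mul_div_mul_left _ _ h5.ne',
    div_le_iff₀ hp] at hM
  exact hM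

/-- The deviation probability is at most `e^{-β D / 4}`, up to a factor subexponential in every
power of `M`. -/
theorem exists_prob_le_exp {q0 : ℕ} (hq : 1 ≤ q0) :
    ∃ K : ℝ, 0 ≤ K ∧ ∀ᶠ M : ℕ in atTop, ∀ N : ℕ, Ncr M < N → ∀ D : ℝ,
      prob q0 M N {n | D < |(n 0 : ℝ) - ((N : ℝ) - Ncr M)|} ≤
        Real.exp (K * Real.log M ^ 5 - root M * D / 4) := by
  obtain ⟨C, hC0, hC⟩ := exists_root_mul_mom_two_le
  have hV := varConst_nonneg
  -- the number of boxes forced to be empty is about `(A log M) ^ 2`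
  set A : ℝ := 16 * (varConst + 15) with hA
  refine ⟨2 * q0 + (varConst + 2) + (C + 1) + 2 * (A ^ 2 + 1) ^ 2 + 8 + 6 + 9, by positivity, ?_⟩
  filter_upwards [hC, eventually_root_mul_log_sq_le A, eventually_log_sq_le A,
    eventually_two_le_root_mul, tendsto_log_atTop.eventually_ge_atTop 1,
    eventually_ge_atTop 2] with M hC hβJ hJM hβM hℓ hM2 N hN D
  have hM : 1 ≤ M := by omega
  have hβ := root_pos hM
  set β := root M with hβdef
  set ℓ := Real.log M with hℓdef
  have hM0 : (0 : ℝ) < M := by exact_mod_cast hM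
  have hM2' : (2 : ℝ) ≤ M := by exact_mod_cast hM2
  have hMexp : (M : ℝ) = Real.exp ℓ := (Real.exp_log hM0).symm
  set J : ℕ := ⌈(A * ℓ) ^ 2⌉₊ with hJ
  have hJ1 : (A * ℓ) ^ 2 ≤ J := Nat.le_ceil _
  have hJ2 : (J : ℝ) ≤ (A * ℓ) ^ 2 + 1 := (Nat.ceil_lt_add_one (by positivity)).le
  have hβ1 : β ≤ 1 := (le_mul_of_one_le_right hβ.le (by linarith [sq_nonneg (A * ℓ)])).trans hβJ
  have hβJ' : β * J ≤ 1 := (mul_le_mul_of_nonneg_left hJ2 hβ.le).trans hβJ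
  have hJM' : J ≤ M := by exact_mod_cast hJ2.trans hJM
  -- with this truncation `M ^ 2 * e ^ (-β b / 2) = M ^ (-2)`
  set b : ℝ := 8 * ℓ / β with hb
  have hβb : β * b = 8 * ℓ := by rw [hb]; field_simp
  have hb0 : 0 < b := by positivity
  have hTb : (M : ℝ) ^ 2 * Real.exp (-(β * b / 2)) ≤ 1 / 2 := by
    have e : (M : ℝ) ^ 2 * Real.exp (-(β * b / 2)) = (Real.exp (2 * ℓ))⁻¹ := by
      rw [hβb, hMexp, ← Real.exp_nat_mul, ← Real.exp_add, ← Real.exp_neg]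
      congr 1; push_cast; ring
    rw [e, one_div]
    exact inv_anti₀ two_pos (by linarith [Real.add_one_le_exp (2 * ℓ)])
  have hbJ : β * b ≤ J / 2 := by
    have h1 : 16 * ℓ ≤ (A * ℓ) ^ 2 := by
      have h2 : 16 * ℓ ≤ A * ℓ := by gcongr; linarith
      exact h2.trans (le_self_pow₀ (by linarith) two_ne_zero)
    rw [hβb]; linarith
  have h2e : 2 ≤ Real.exp 1 := by linarith [Real.add_one_le_exp 1]
  have hpow2 : ∀ k : ℕ, (2 : ℝ) ^ k ≤ Real.exp k := fun k => by
    rw [← mul_one (k : ℝ), Real.exp_nat_mul]; exact pow_le_pow_left₀ (by norm_num) h2e k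
  have hS : Real.exp (varConst - Real.sqrt J / 16) ≤ 1 / (64 * ((M : ℝ) ^ 2 + 1) ^ 3) := by
    have h1 : A * ℓ ≤ Real.sqrt J := Real.le_sqrt_of_sq_le hJ1
    have h3 : 64 * ((M : ℝ) ^ 2 + 1) ^ 3 ≤ Real.exp (9 + 6 * ℓ) := by
      calc 64 * ((M : ℝ) ^ 2 + 1) ^ 3 ≤ 64 * (2 * (M : ℝ) ^ 2) ^ 3 := by
            gcongr
            linarith [one_le_pow₀ (n := 2) (one_le_two.trans hM2')]
        _ = 2 ^ 9 * (M : ℝ) ^ 6 := by ring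
        _ ≤ Real.exp 9 * Real.exp (6 * ℓ) := by
            refine mul_le_mul (by exact_mod_cast hpow2 9) (le_of_eq ?_) (by positivity)
              (Real.exp_pos _).le
            rw [hMexp, ← Real.exp_nat_mul]; norm_num
        _ = _ := (Real.exp_add _ _).symm
    refine le_trans ?_ (one_div_le_one_div_of_le (by positivity) h3)
    rw [one_div, ← Real.exp_neg]
    refine Real.exp_le_exp.mpr ?_
    have h4 : (varConst + 15) * ℓ ≤ Real.sqrt J / 16 := by
      rw [hA] at h1; linarith
    have h5 : varConst ≤ varConst * ℓ := le_mul_of_one_le_right hV hℓ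
    linarith
  classical
  have hden := le_sum_excitedWeight hM hJM' hβdef hβ1 hβJ' hb0 hTb hbJ hS hC hN
  have hnum := sum_deviating_le hM N hβ1 D
  rw [← hβdef, partition_range_eq hJM'] at hnum
  have hZJ := partition_range_le hβ hβ1 J
  have hZJ' : partition β (Finset.range J) ≤ Real.exp (ℓ * (J : ℝ) ^ 2) := by
    refine hZJ.trans ?_
    have h1 : 2 / β ≤ Real.exp ℓ := by
      rw [← hMexp, div_le_iff₀ hβ, mul_comm]; exact hβM
    refine (pow_le_pow_left₀ (by positivity) h1 _).trans (le_of_eq ?_)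
    rw [← Real.exp_nat_mul]; congr 1; push_cast; ring
  have hZ := partition_pos hβ (Finset.Ico J M)
  have hZ0 := partition_pos hβ (Finset.range J)
  have hM3 : (M : ℝ) ^ 2 + 1 ≤ Real.exp (3 * ℓ) := by
    have e : Real.exp (3 * ℓ) = (M : ℝ) ^ 3 := by rw [hMexp, ← Real.exp_nat_mul]; norm_num
    rw [e]; nlinarith [sq_nonneg (M : ℝ)]
  have hM1 : (M : ℝ) + 1 ≤ Real.exp (2 * ℓ) := by
    have e : Real.exp (2 * ℓ) = (M : ℝ) ^ 2 := by rw [hMexp, ← Real.exp_nat_mul]; norm_num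
    rw [e]; nlinarith
  have hJ4 : (J : ℝ) ^ 2 ≤ (A ^ 2 + 1) ^ 2 * ℓ ^ 4 := by
    have h1 : (J : ℝ) ≤ (A ^ 2 + 1) * ℓ ^ 2 := by
      have h2 : 1 ≤ ℓ ^ 2 := one_le_pow₀ hℓ
      rw [mul_pow] at hJ2
      linarith
    calc (J : ℝ) ^ 2 ≤ ((A ^ 2 + 1) * ℓ ^ 2) ^ 2 := pow_le_pow_left₀ (Nat.cast_nonneg _) h1 2
      _ = _ := by ring
  set X := ∑ n ∈ (configs_finite M N).toFinset with
        n ∈ {n : ℕ →₀ ℕ | D < |(n 0 : ℝ) - ((N : ℝ) - Ncr M)|}, (excitedWeight M n : ℝ)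
  set B := ∑ n ∈ (configs_finite M N).toFinset, (excitedWeight M n : ℝ)
  have hB : 0 < B := lt_of_lt_of_le (by positivity) hden
  -- the ratio of the two bounds
  have hratio : X / B ≤ Real.exp (1 + (varConst + 1) + ℓ * (J : ℝ) ^ 2 - β * D / 4 +
      (C + (J : ℝ) ^ 2 + 1 + 8 * ℓ) + (6 + 9 * ℓ)) := by
    rw [div_le_iff₀ hB]
    have h64 : 1 / Real.exp (6 + 9 * ℓ) ≤ 1 / (64 * ((M : ℝ) ^ 2 + 1) ^ 3) := by
      refine one_div_le_one_div_of_le (by positivity) ?_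
      rw [Real.exp_add]
      refine mul_le_mul ?_ ?_ (by positivity) (Real.exp_pos _).le
      · have := hpow2 6; norm_num at this; exact this
      · refine (pow_le_pow_left₀ (by positivity) hM3 3).trans (le_of_eq ?_)
        rw [← Real.exp_nat_mul]; congr 1; push_cast; ring
    calc X ≤ _ := hnum
      _ ≤ Real.exp 1 * Real.exp (varConst + 1) * Real.exp (β * M) *
          (Real.exp (ℓ * (J : ℝ) ^ 2) * partition β (Finset.Ico J M)) *
            Real.exp (-(β * D / 4)) := by gcongr
      _ = Real.exp (1 + (varConst + 1) + ℓ * (J : ℝ) ^ 2 - β * D / 4 +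
          (C + (J : ℝ) ^ 2 + 1 + 8 * ℓ) + (6 + 9 * ℓ)) *
          (Real.exp (β * M - (C + (J : ℝ) ^ 2 + 1 + β * b)) *
          (partition β (Finset.Ico J M) * (1 / Real.exp (6 + 9 * ℓ)))) := by
          rw [hβb, one_div, ← Real.exp_neg]
          have e : ∀ a c d P : ℝ, Real.exp a * (Real.exp c * (P * Real.exp d)) =
              P * Real.exp (a + c + d) := fun a c d P => by
            rw [Real.exp_add, Real.exp_add]; ring
          have e' : ∀ a c d f g P : ℝ, Real.exp a * Real.exp c * Real.exp d *
              (Real.exp f * P) * Real.exp g = P * Real.exp (a + c + d + f + g) :=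
            fun a c d f g P => by simp only [Real.exp_add]; ring
          rw [e, e']
          congr 2
          ring
      _ ≤ _ := by
          refine mul_le_mul_of_nonneg_left (le_trans ?_ hden) (Real.exp_pos _).le
          gcongr
  refine (prob_le hq M N _).trans ?_
  have hq0 : ((M : ℝ) + 1) ^ q0 ≤ Real.exp (2 * q0 * ℓ) := by
    refine (pow_le_pow_left₀ (by positivity) hM1 q0).trans (le_of_eq ?_)
    rw [← Real.exp_nat_mul]; congr 1; ring
  refine (mul_le_mul hq0 hratio (div_nonneg (Finset.sum_nonneg fun _ _ => Nat.cast_nonneg _) hB.le)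
    (Real.exp_pos _).le).trans ?_
  rw [← Real.exp_add]
  refine Real.exp_le_exp.mpr ?_
  have p1 : ℓ ≤ ℓ ^ 5 := le_self_pow₀ hℓ (by norm_num)
  have p0 : 1 ≤ ℓ ^ 5 := one_le_pow₀ hℓ
  have p4 : ℓ ^ 4 ≤ ℓ ^ 5 := pow_le_pow_right₀ hℓ (by norm_num)
  have t1 : ℓ * (J : ℝ) ^ 2 ≤ (A ^ 2 + 1) ^ 2 * ℓ ^ 5 := by
    calc ℓ * (J : ℝ) ^ 2 ≤ ℓ * ((A ^ 2 + 1) ^ 2 * ℓ ^ 4) := by gcongr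
      _ = _ := by ring
  have t2 : (J : ℝ) ^ 2 ≤ (A ^ 2 + 1) ^ 2 * ℓ ^ 5 := hJ4.trans (by gcongr)
  have t3 : 2 * q0 * ℓ ≤ 2 * q0 * ℓ ^ 5 := by gcongr
  have t4 : varConst + 2 ≤ (varConst + 2) * ℓ ^ 5 := le_mul_of_one_le_right (by linarith) p0
  have t5 : C + 1 ≤ (C + 1) * ℓ ^ 5 := le_mul_of_one_le_right (by linarith) p0
  linarith

theorem tendsto_Ncr : Tendsto Ncr atTop atTop := by
  have hc : 0 < boseConst 0 / boseConst 1 ^ (3 / 5 : ℝ) :=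
    div_pos (boseConst_pos 0) (Real.rpow_pos_of_pos (boseConst_pos 1) _)
  have h : Tendsto (fun M : ℕ => (M : ℝ) ^ (3 / 5 : ℝ)) atTop atTop :=
    (tendsto_rpow_atTop (by norm_num)).comp tendsto_natCast_atTop_atTop
  refine (tendsto_Ncr_div.pos_mul_atTop hc h).congr' ?_
  filter_upwards [eventually_ge_atTop 1] with M hM
  have hp : (0 : ℝ) < (M : ℝ) ^ (3 / 5 : ℝ) := Real.rpow_pos_of_pos (by exact_mod_cast hM) _
  field_simp

/-- `N_cr` is of order `M ^ (3 / 5)`, hence eventually at least `√M`. -/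
theorem eventually_log_le : ∀ᶠ M : ℕ in atTop, Real.log M ≤ 2 * Real.log (Ncr M) := by
  have hc : 0 < boseConst 0 / boseConst 1 ^ (3 / 5 : ℝ) :=
    div_pos (boseConst_pos 0) (Real.rpow_pos_of_pos (boseConst_pos 1) _)
  have h : Tendsto (fun M : ℕ => (M : ℝ) ^ (1 / 10 : ℝ)) atTop atTop :=
    (tendsto_rpow_atTop (by norm_num)).comp tendsto_natCast_atTop_atTop
  filter_upwards [(tendsto_Ncr_div.pos_mul_atTop hc h).eventually_ge_atTop 1,
    eventually_ge_atTop 1] with M hM hM1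
  have hp : (0 : ℝ) < M := by exact_mod_cast hM1
  have h1 : (M : ℝ) ^ (1 / 2 : ℝ) ≤ Ncr M := by
    have h3 := Real.rpow_pos_of_pos hp (3 / 5)
    have h2 := Real.rpow_pos_of_pos hp (1 / 2)
    have e : (M : ℝ) ^ (3 / 5 : ℝ) = (M : ℝ) ^ (1 / 2 : ℝ) * (M : ℝ) ^ (1 / 10 : ℝ) := by
      rw [← Real.rpow_add hp]; norm_num
    rw [div_mul_eq_mul_div, le_div_iff₀ h3, one_mul, e] at hM
    exact le_of_mul_le_mul_right hM (Real.rpow_pos_of_pos hp _)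
  have h2 := Real.log_le_log (Real.rpow_pos_of_pos hp _) h1
  rw [Real.log_rpow hp] at h2
  linarith

/-- `β N_cr^{2/3}` tends to a positive limit. -/
theorem exists_le_root_mul_width :
    ∃ κ : ℝ, 0 < κ ∧ ∀ ε : ℝ, ∀ᶠ M : ℕ in atTop, κ * Ncr M ^ ε ≤ root M * width ε M := by
  have h0 : 0 < boseConst 0 ^ (2 / 3 : ℝ) := Real.rpow_pos_of_pos (boseConst_pos 0) _
  have h := tendsto_root_rpow_mul_Ncr.rpow_const (p := 2 / 3) (Or.inr (by norm_num))
  refine ⟨boseConst 0 ^ (2 / 3 : ℝ) / 2, by positivity, fun ε => ?_⟩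
  filter_upwards [h.eventually_const_le (half_lt_self h0), eventually_ge_atTop 1] with M hM hM1
  have hβ := root_pos hM1
  have hN := Ncr_pos hM1
  rw [Real.mul_rpow (by positivity) hN.le, ← Real.rpow_mul hβ.le] at hM
  norm_num at hM
  rw [width, Real.rpow_add hN, ← mul_assoc]
  exact mul_le_mul_of_nonneg_right hM (Real.rpow_nonneg hN.le _)

theorem eventually_prob_le {q0 : ℕ} (hq : 1 ≤ q0) {ε : ℝ} (hε : 0 < ε) (m : ℕ) :
    ∀ᶠ M : ℕ in atTop, ∀ N : ℕ, Ncr M < N →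
      prob q0 M N {n | width ε M < |(n 0 : ℝ) - ((N : ℝ) - Ncr M)|} ≤ Ncr M ^ (-(m : ℤ)) := by
  obtain ⟨K, hK0, hK⟩ := exists_prob_le_exp hq
  obtain ⟨κ, hκ, hwidth⟩ := exists_le_root_mul_width
  have hlog : Tendsto (fun M : ℕ => Real.log (Ncr M)) atTop atTop :=
    Real.tendsto_log_atTop.comp tendsto_Ncr
  set δ : ℝ := κ / 4 / (32 * K + m + 1) with hδ
  have hδ0 : 0 < δ := by positivity
  have ho := hlog.eventually ((isLittleO_pow_exp_pos_mul_atTop 5 hε).bound hδ0)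
  filter_upwards [hK, hwidth ε, ho, eventually_log_le, hlog.eventually_ge_atTop 1,
    tendsto_log_atTop.eventually_ge_atTop 0, eventually_ge_atTop 1]
    with M hK hw ho hl hL hℓ hM N hN
  have hNcr := Ncr_pos hM
  refine (hK N hN _).trans ?_
  set L := Real.log (Ncr M) with hLdef
  have e : Ncr M ^ (-(m : ℤ)) = Real.exp (-(m * L)) := by
    rw [zpow_neg, zpow_natCast, Real.exp_neg, Real.exp_nat_mul, hLdef, Real.exp_log hNcr]
  have e2 : Ncr M ^ ε = Real.exp (ε * L) := by rw [Real.rpow_def_of_pos hNcr, mul_comm]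
  rw [e]
  refine Real.exp_le_exp.mpr ?_
  rw [Real.norm_of_nonneg (by positivity), Real.norm_of_nonneg (Real.exp_pos _).le, hδ,
    div_mul_eq_mul_div, le_div_iff₀ (by positivity)] at ho
  rw [e2] at hw
  have h5 : Real.log M ^ 5 ≤ 32 * L ^ 5 := by
    calc Real.log M ^ 5 ≤ (2 * L) ^ 5 := pow_le_pow_left₀ hℓ hl 5
      _ = _ := by ring
  have h1 : L ≤ L ^ 5 := le_self_pow₀ hL (by norm_num)
  have h2 : (m : ℝ) * L ≤ m * L ^ 5 := by gcongr
  have h3 : K * Real.log M ^ 5 ≤ K * (32 * L ^ 5) := by gcongr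
  have h4 : 0 ≤ L ^ 5 := by positivity
  linarith

theorem exists_prob_le {q0 : ℕ} (hq : 1 ≤ q0) {ε : ℝ} (hε : 0 < ε) (m : ℕ) :
    ∃ C : ℝ, ∀ M N : ℕ, 1 ≤ M → Ncr M < N →
      prob q0 M N {n | width ε M < |(n 0 : ℝ) - ((N : ℝ) - Ncr M)|} ≤
        C * Ncr M ^ (-(m : ℤ)) := by
  obtain ⟨M₀, h⟩ := eventually_atTop.mp (eventually_prob_le hq hε m)
  -- below `M₀` the trivial bound `1` suffices
  refine ⟨1 + ∑ M ∈ Finset.range M₀, |Ncr M| ^ m, fun M N hM hN => ?_⟩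
  have hNcr := Ncr_pos hM
  have hp : 0 < Ncr M ^ (-(m : ℤ)) := zpow_pos hNcr _
  have hs : 0 ≤ ∑ M ∈ Finset.range M₀, |Ncr M| ^ m := Finset.sum_nonneg fun _ _ => by positivity
  rcases le_or_gt M₀ M with hle | hlt
  · refine (h M hle N hN).trans (le_mul_of_one_le_left hp.le (by linarith))
  · refine (prob_le_one hq M N _).trans ?_
    have h1 : Ncr M ^ m ≤ ∑ M ∈ Finset.range M₀, |Ncr M| ^ m := by
      have := Finset.single_le_sum (f := fun M => |Ncr M| ^ m) (fun _ _ => by positivity)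
        (Finset.mem_range.mpr hlt)
      simp only [abs_of_pos hNcr] at this
      exact this
    calc (1 : ℝ) = Ncr M ^ m * Ncr M ^ (-(m : ℤ)) := by
          rw [zpow_neg, zpow_natCast]; field_simp
      _ ≤ _ := by gcongr; linarith

theorem eventually_le_prob {q0 : ℕ} (hq : 1 ≤ q0) {ε : ℝ} (hε : 0 < ε) {δ : ℝ} (hδ : 0 < δ) :
    ∀ᶠ M : ℕ in atTop, ∀ N : ℕ, Ncr M < N →
      1 - δ ≤ prob q0 M N {n | |(n 0 : ℝ) - ((N : ℝ) - Ncr M)| ≤ width ε M} := by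
  have h := tendsto_Ncr.inv_tendsto_atTop.eventually_le_const hδ
  filter_upwards [eventually_prob_le hq hε 1, h] with M hM hδM N hN
  have h1 := hM N hN
  have h2 := prob_add_prob_compl hq M N {n | width ε M < |(n 0 : ℝ) - ((N : ℝ) - Ncr M)|}
  have e : {n : ℕ →₀ ℕ | width ε M < |(n 0 : ℝ) - ((N : ℝ) - Ncr M)|}ᶜ =
      {n | |(n 0 : ℝ) - ((N : ℝ) - Ncr M)| ≤ width ε M} := by
    ext n; simp
  rw [e] at h2
  simp only [Nat.cast_one, zpow_neg, zpow_one] at h1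
  rw [Pi.inv_apply] at hδM
  linarith

end BoxCondensation

theorem mainTheorem3 :
    -- the equation for `β` has exactly one positive root, and the series for `N_cr` converges
    (∀ M : ℕ, 1 ≤ M → (∃! β : ℝ, BoxCondensation.IsRoot M β) ∧
      Summable (BoxCondensation.critTerm M)) ∧
    -- the condensation estimate, uniformly in `M` and `N`
    (∀ (q0 : ℕ) (ε : ℝ), 1 ≤ q0 → 0 < ε → ∀ m : ℕ, 1 ≤ m →
      ∃ C : ℝ, ∀ M N : ℕ, 1 ≤ M → BoxCondensation.Ncr M < (N : ℝ) →
        BoxCondensation.prob q0 M N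
            {n | BoxCondensation.width ε M < |(n 0 : ℝ) - ((N : ℝ) - BoxCondensation.Ncr M)|}
          ≤ C * BoxCondensation.Ncr M ^ (-(m : ℤ))) ∧
    -- the number of balls in box `U_0` is close to `N - N_cr` with probability tending to `1`
    -- as `M → ∞`, uniformly in `N > N_cr`
    (∀ (q0 : ℕ) (ε : ℝ), 1 ≤ q0 → 0 < ε → ∀ δ : ℝ, 0 < δ →
      ∀ᶠ M : ℕ in Filter.atTop, ∀ N : ℕ, BoxCondensation.Ncr M < (N : ℝ) →
        1 - δ ≤ BoxCondensation.prob q0 M N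
          {n | |(n 0 : ℝ) - ((N : ℝ) - BoxCondensation.Ncr M)| ≤ BoxCondensation.width ε M}) ∧
    -- the asymptotics of `N_cr(M)` as `M → ∞`
    Asymptotics.IsEquivalent Filter.atTop BoxCondensation.Ncr
      (fun M : ℕ => (M : ℝ) ^ (3 / 5 : ℝ) *
        (Real.Gamma (3 / 2) * (riemannZeta (3 / 2)).re) /
          (Real.Gamma (5 / 2) * (riemannZeta (5 / 2)).re) ^ (3 / 5 : ℝ)) := by
  exact ⟨fun _ hM => ⟨BoxCondensation.existsUnique_isRoot hM, BoxCondensation.summable_critTerm hM⟩,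
    fun _ _ hq hε m _ => BoxCondensation.exists_prob_le hq hε m,
    fun _ _ hq hε _ hδ => BoxCondensation.eventually_le_prob hq hε hδ,
    BoxCondensation.isEquivalent_Ncr⟩
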